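/- Let $P$ be an irreducible rational quasi-affine variety of dimension $n$ over $\mathbb C$, with an algebraic Poisson structure $\pi$, i.e. a Poisson bracket on $\mathbb C[P]$, extended to $\mathbb C(P)$. A (generalized) seed in $\mathbb C(P)$ consists of an extended cluster $\Phi=(\varphi_1,\dots,\varphi_n)$, which is algebraically independent and generates the field $\mathbb C(P)$ over $\mathbb C$, an exchange set $\mathrm{ex}\subset[1,n]$, an integer matrix $M=(m_{i,j})_{i\in[1,n],\,j\in \mathrm{ex}}$ with skew-symmetrizable $\mathrm{ex}\times\mathrm{ex}$ part, positive integers $d_k$ ($k\in\mathrm{ex}$) with $d_k\mid m_{i,k}$ for $i\in\mathrm{ex}$, and polynomials $p_{k,0}=1,p_{k,1},\dots,p_{k,d_k}=1$ (for instance monomials) in the frozen variables $\varphi_j$, $j\notin \mathrm{ex}$. The mutation in direction $k\in\mathrm{ex}$ replaces $\varphi_k$ by $\varphi_k'$, where $$\varphi_k\varphi_k'=\sum_{r=0}^{d_k}p_{k,r}\prod_{m_{j,k}>0}\varphi_j^{\lfloor r m_{j,k}/d_k\rfloor}\prod_{m_{j,k}<0}\varphi_j^{\lfloor -(d_k-r)m_{j,k}/d_k\rfloor},$$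 replaces $m_{i,j}$ by $-m_{i,j}$ if $i=k$ or $j=k$ and by $m_{i,j}+\frac12(|m_{i,k}|m_{k,j}+m_{i,k}|m_{k,j}|)$ otherwise, replaces $p_{k,r}$ by $p_{k,d_k-r}$, and changes nothing else (the case $d_k=1$ for all $k$ is ordinary mutation). Let $\mathcal C$ be a (generalized) mutation class, i.e. the set of seeds obtained from one seed by sequences of mutations. Assume that $\mathcal C$ is regular on $P$ (all cluster and frozen variables of $\mathcal C$ lie in $\mathbb C[P]$) and compatible with $\pi$ (for every extended cluster $\Phi$ of $\mathcal C$ and all $i,j$ one has $\{\varphi_i,\varphi_j\}_\pi\in\mathbb C\,\varphi_i\varphi_j$). Let $(\overline\varphi_j)_{j\notin\mathrm{ex}}$ be a frozen variable modification of $\mathcal C$: elements of $\mathbb C[\varphi_i: i\notin\mathrm{ex}]$ with linearly independent differentials, each of the form $\overline\varphi_j=c_jM_j$ with $c_j\in\mathbb C(P)$ a Casimir function and $M_j$ a monomial in the frozen variables. For an extended cluster $\Phi$ of $\mathcal C$ let $\overline\Phi$ be obtained from $\Phi$ by replacing $\varphi_j$ by $\overline\varphi_j$ for every $j\notin\mathrm{ex}$,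 and let $\mu_{\overline\Phi}$ be the rational $n$-form obtained by dividing the exterior product of the differentials of the members of $\overline\Phi$ by the product of these members. Then: 0) Every $\overline\Phi$ is a log-canonical system on $(P,\pi)$: it consists of $n$ regular functions whose differentials have nonzero exterior product and whose pairwise Poisson brackets are log-canonical, i.e. $\{f,g\}_\pi\in\mathbb C fg$. 1) The form $\overline\mu_{\mathcal C}=\mu_{\overline\Phi}$ is, up to multiplication by $-1$, independent of the choice of the extended cluster $\Phi$ of $\mathcal C$. 2) Let $p_0\in P$ be a smooth point with $\pi(p_0)=0$, and let $\pi_0$ be the linearization of $\pi$ at $p_0$, i.e. the linear Poisson structure on $T_{p_0}P$ given by the Lie bracket $[d_{p_0}f,d_{p_0}g]=d_{p_0}\{f,g\}_\pi$ on $T^*_{p_0}P$. Let $\mathrm{rk}(\pi_0)$ be the maximum of the ranks of $\pi_0(v)$, $v\in T_{p_0}P$. Let $f^{\rm low}$ denote the lowest degree homogeneous part of the Taylor expansion at $p_0$ of a nonzero regular function $f$ in local holomorphic coordinates $z_1,\dots,z_n$ centred at $p_0$, regarded as a polynomial function on $T_{p_0}P$. For a nonzero rational $n$-form $\omega=(h/g)\,dz_1\wedge\dots\wedge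 dz_n$, with $h,g$ holomorphic near $p_0$, let $\deg(\omega^{\rm low})=\deg(h^{\rm low})+n-\deg(g^{\rm low})$. If $$\deg\bigl((\overline\mu_{\mathcal C})^{\rm low}\bigr)=\tfrac12\,\mathrm{rk}(\pi_0),$$ then for every extended cluster $\Phi$ of $\mathcal C$ the lowest degree terms of the $n$ members of $\overline\Phi$ contain a polynomial integrable system on $(T_{p_0}P,\pi_0)$: they Poisson commute pairwise with respect to $\pi_0$, and $n-\frac12\mathrm{rk}(\pi_0)$ of them are independent, i.e. the exterior product of their differentials is not identically zero. -/

import Mathlib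

open scoped Topology KaehlerDifferential

noncomputable section

namespace ClusterPoisson

/-! ### Irreducible quasi-affine varieties over `ℂ` -/

/-- An irreducible quasi-affine variety in affine `N`-space over `ℂ`: a Zariski locally closed
subset of `ℂ^N` which is irreducible (its vanishing ideal is prime; in particular it is
non-empty). -/
structure QuasiAffineVariety (N : ℕ) where
  carrier : Set (Fin N → ℂ)
  locallyClosed : ∃ I J : Ideal (MvPolynomial (Fin N) ℂ),
    carrier = MvPolynomial.zeroLocus ℂ I \ MvPolynomial.zeroLocus ℂ J
  irreducible : (MvPolynomial.vanishingIdeal ℂ carrier).IsPrime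

namespace QuasiAffineVariety

variable {N : ℕ} (V : QuasiAffineVariety N)

/-- The ideal of the polynomials that vanish on the variety. -/
abbrev ideal : Ideal (MvPolynomial (Fin N) ℂ) := MvPolynomial.vanishingIdeal ℂ V.carrier

instance : V.ideal.IsPrime := V.irreducible

/-- The ring of polynomial functions on the variety. -/
abbrev CoordRing : Type := MvPolynomial (Fin N) ℂ ⧸ V.ideal

/-- The field `ℂ(P)` of rational functions on the variety `P`. -/
abbrev FunctionField : Type := FractionRing V.CoordRing

/-- A polynomial in the coordinates of the ambient space, as a rational function on `P`. -/
def ofPoly (a : MvPolynomial (Fin N) ℂ) : V.FunctionField :=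
  algebraMap V.CoordRing V.FunctionField (Ideal.Quotient.mk V.ideal a)

/-- The variety `P` is rational of dimension `n`: the field `ℂ(P)` is isomorphic over `ℂ` to the
field of rational functions in `n` variables. -/
def IsRational (n : ℕ) : Prop :=
  Nonempty (V.FunctionField ≃ₐ[ℂ] FractionRing (MvPolynomial (Fin n) ℂ))

/-- The rational function `f` is regular at the point `p`. -/
def RegularAt (f : V.FunctionField) (p : Fin N → ℂ) : Prop :=
  ∃ ab : MvPolynomial (Fin N) ℂ × MvPolynomial (Fin N) ℂ,
    MvPolynomial.eval p ab.2 ≠ 0 ∧ f = V.ofPoly ab.1 / V.ofPoly ab.2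

/-- The rational function `f` is a regular function on `P`, i.e. an element of `ℂ[P]`. -/
def IsRegular (f : V.FunctionField) : Prop := ∀ p ∈ V.carrier, V.RegularAt f p

open Classical in
/-- The value of the rational function `f` at a point `p` of `P` where `f` is regular (it does not
depend on the fraction that represents `f`); it is `0` where `f` is not regular. -/
def value (f : V.FunctionField) (p : Fin N → ℂ) : ℂ :=
  if h : V.RegularAt f p then
    MvPolynomial.eval p h.choose.1 / MvPolynomial.eval p h.choose.2
  else 0

/-- The Zariski tangent space of `P` at `p`, as a subspace of `ℂ^N`. -/
def zariskiTangent (p : Fin N → ℂ) : Submodule ℂ (Fin N → ℂ) :=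
  ⨅ a ∈ V.ideal, LinearMap.ker
    (∑ i : Fin N, MvPolynomial.eval p (MvPolynomial.pderiv i a) •
      (LinearMap.proj i : (Fin N → ℂ) →ₗ[ℂ] ℂ))

/-- The point `p` of the `n`-dimensional variety `P` is smooth. -/
def IsSmoothPoint (n : ℕ) (p : Fin N → ℂ) : Prop :=
  p ∈ V.carrier ∧ Module.finrank ℂ (V.zariskiTangent p) = n

/-- A local holomorphic coordinate system `z = (z₁, …, zₙ)` on `P` near `p` with `z(p) = 0`, given
by its inverse `γ`: the germ at `0 ∈ ℂⁿ` of a holomorphic immersion which maps the neighbourhoods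
of `0` onto the neighbourhoods of `p` in `P` (for the Euclidean topology). The coordinates
`v_i = d_p z_i` identify the tangent space of `P` at `p` with `ℂⁿ`. -/
structure IsCoordinateSystem {n : ℕ} (p : Fin N → ℂ) (γ : (Fin n → ℂ) → (Fin N → ℂ)) : Prop where
  base : γ 0 = p
  analytic : AnalyticAt ℂ γ 0
  immersion : Function.Injective (fderiv ℂ γ 0)
  map_nhds : Filter.map γ (𝓝 0) = 𝓝[V.carrier] p

/-- The function `f` on `P` written in the coordinates `z`. -/
def inCoord {n : ℕ} (γ : (Fin n → ℂ) → (Fin N → ℂ)) (f : V.FunctionField) : (Fin n → ℂ) → ℂ :=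
  fun z => V.value f (γ z)

end QuasiAffineVariety

/-! ### Lowest degree terms -/

/-- The polynomial `F` is the lowest degree term at `0` of the holomorphic function germ `h` at
`0 ∈ ℂⁿ`, and `e` is its degree: the Taylor expansion of `h` at `0` is `F`, which is nonzero and
homogeneous of degree `e`, plus terms of degree at least `e + 1`. -/
def IsLowestTerm {n : ℕ} (h : (Fin n → ℂ) → ℂ) (F : MvPolynomial (Fin n) ℂ) (e : ℕ) : Prop :=
  F ≠ 0 ∧ F.IsHomogeneous e ∧
    (fun z => h z - MvPolynomial.eval z F) =O[𝓝 0] (fun z => ‖z‖ ^ (e + 1))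

namespace QuasiAffineVariety

variable {N : ℕ} (V : QuasiAffineVariety N)

/-- The module of rational `n`-forms on `P`. -/
abbrev RationalForm (n : ℕ) : Type := ⋀[V.FunctionField]^n (Ω[V.FunctionField⁄ℂ])

/-- The rational `n`-form `df₁ ∧ ⋯ ∧ dfₙ`. -/
def wedgeD {n : ℕ} (f : Fin n → V.FunctionField) : V.RationalForm n :=
  exteriorPower.ιMulti V.FunctionField n (fun i => KaehlerDifferential.D ℂ V.FunctionField (f i))

/-- The log-volume form `(df₁ ∧ ⋯ ∧ dfₙ) / (f₁ ⋯ fₙ)`. -/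
def logVolumeForm {n : ℕ} (f : Fin n → V.FunctionField) : V.RationalForm n :=
  (∏ i, f i)⁻¹ • V.wedgeD f

/-- The function `h` such that `a db₁ ∧ ⋯ ∧ dbₙ = h dz₁ ∧ ⋯ ∧ dzₙ` in the coordinates `z`. -/
def coeffInCoord {n : ℕ} (γ : (Fin n → ℂ) → (Fin N → ℂ)) (a : V.FunctionField)
    (b : Fin n → V.FunctionField) : (Fin n → ℂ) → ℂ :=
  fun z => V.inCoord γ a z *
    (Matrix.of fun i j : Fin n => fderiv ℂ (V.inCoord γ (b i)) z (Pi.single j 1)).det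

/-- The lowest degree term at `p` of the rational `n`-form `ω` is the rational `n`-form
`(F / G) dv₁ ∧ ⋯ ∧ dvₙ` on the tangent space, with `F` and `G` homogeneous of degrees `e` and `e'`.
Here `ω = α / g` with `α = a db₁ ∧ ⋯ ∧ dbₙ` holomorphic near `p` and `g` holomorphic near `p`, and
`F dv₁ ∧ ⋯ ∧ dvₙ` and `G` are the lowest degree terms of `α` and `g`. -/
def IsLowestTermOfForm {n : ℕ} (p : Fin N → ℂ) (γ : (Fin n → ℂ) → (Fin N → ℂ))
    (ω : V.RationalForm n) (F G : MvPolynomial (Fin n) ℂ) (e e' : ℕ) : Prop :=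
  ∃ (a g : V.FunctionField) (b : Fin n → V.FunctionField),
    V.RegularAt a p ∧ V.RegularAt g p ∧ (∀ i, V.RegularAt (b i) p) ∧ g ≠ 0 ∧
    ω = (a / g) • V.wedgeD b ∧
    IsLowestTerm (V.coeffInCoord γ a b) F e ∧ IsLowestTerm (V.inCoord γ g) G e'

/-- The lowest degree term at `p` of the rational `n`-form `ω` exists and has degree `d`, where
`(F / G) dv₁ ∧ ⋯ ∧ dvₙ` has degree `(deg F + n) - deg G`. -/
def HasLowestDegree {n : ℕ} (p : Fin N → ℂ) (γ : (Fin n → ℂ) → (Fin N → ℂ))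
    (ω : V.RationalForm n) (d : ℤ) : Prop :=
  ∃ F G e e', V.IsLowestTermOfForm p γ ω F G e e' ∧ d = ((e : ℤ) + n) - e'

/-! ### Poisson structures and linearization -/

/-- An algebraic Poisson structure on `P`: a Poisson bracket on `ℂ(P)` which maps regular functions
on `P` to regular functions on `P`. -/
structure PoissonStructure where
  bracket : V.FunctionField →ₗ[ℂ] V.FunctionField →ₗ[ℂ] V.FunctionField
  bracket_self : ∀ f, bracket f f = 0
  jacobi : ∀ f g h,
    bracket f (bracket g h) + bracket g (bracket h f) + bracket h (bracket f g) = 0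
  leibniz : ∀ f g h, bracket f (g * h) = bracket f g * h + g * bracket f h
  regular : ∀ f g, V.IsRegular f → V.IsRegular g → V.IsRegular (bracket f g)

end QuasiAffineVariety

/-- The cotangent space `T*` of `ℂⁿ` at a point. -/
abbrev Cotangent (n : ℕ) : Type := (Fin n → ℂ) →L[ℂ] ℂ

namespace QuasiAffineVariety.PoissonStructure

variable {N : ℕ} {V : QuasiAffineVariety N} (π : V.PoissonStructure)

/-- `π(p) = 0`. -/
def VanishesAt (p : Fin N → ℂ) : Prop :=
  ∀ f g, V.RegularAt f p → V.RegularAt g p → V.value (π.bracket f g) p = 0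

/-- Casimir functions in `ℂ(P)`. -/
def IsCasimir (c : V.FunctionField) : Prop := ∀ g, π.bracket c g = 0

/-- The elements `f i` of `ℂ(P)` have pairwise log-canonical Poisson brackets. -/
def IsLogCanonical {n : ℕ} (f : Fin n → V.FunctionField) : Prop :=
  ∀ i j, ∃ c : ℂ, π.bracket (f i) (f j) = c • (f i * f j)

/-- Log-canonical systems on the `n`-dimensional Poisson variety `P`: independent regular functions
`f₁, …, fₙ` with pairwise log-canonical Poisson brackets. -/
def IsLogCanonicalSystem {n : ℕ} (f : Fin n → V.FunctionField) : Prop :=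
  (∀ i, V.IsRegular (f i)) ∧ V.wedgeD f ≠ 0 ∧ π.IsLogCanonical f

/-- `L` is the bracket `[d_p f, d_p g] = d_p {f, g}` on the cotangent space of `P` at `p`, in the
coordinates `z`. -/
def IsLinearization {n : ℕ} (p : Fin N → ℂ) (γ : (Fin n → ℂ) → (Fin N → ℂ))
    (L : Cotangent n →ₗ[ℂ] Cotangent n →ₗ[ℂ] Cotangent n) : Prop :=
  ∀ f g, V.RegularAt f p → V.RegularAt g p →
    L (fderiv ℂ (V.inCoord γ f) 0) (fderiv ℂ (V.inCoord γ g) 0) =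
      fderiv ℂ (V.inCoord γ (π.bracket f g)) 0

/-- The Lie bracket on the cotangent space of `P` at a smooth point `p` with `π(p) = 0`, in the
coordinates `z`: the one and only bracket with `[d_p f, d_p g] = d_p {f, g}` for all `f` and `g`
regular at `p`. It is the linearization `π₀` of `π` at `p`, a linear Poisson structure on the
tangent space `ℂⁿ`. -/
def linearization {n : ℕ} (p : Fin N → ℂ) (γ : (Fin n → ℂ) → (Fin N → ℂ)) :
    Cotangent n →ₗ[ℂ] Cotangent n →ₗ[ℂ] Cotangent n :=
  Classical.epsilon (π.IsLinearization p γ)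

end QuasiAffineVariety.PoissonStructure

/-! ### Linear Poisson structures and polynomial integrable systems

A linear Poisson structure on `ℂⁿ` is given by a Lie bracket `L` on the dual space. -/

section Linear

variable {n : ℕ}

/-- The differential `d_v F` of the polynomial function `F` on `ℂⁿ`. -/
def polyD (F : MvPolynomial (Fin n) ℂ) (v : Fin n → ℂ) : Cotangent n :=
  fderiv ℂ (fun w => MvPolynomial.eval w F) v

variable (L : Cotangent n →ₗ[ℂ] Cotangent n →ₗ[ℂ] Cotangent n)

/-- The value `π₀(v) : (ξ, η) ↦ ⟨[ξ, η], v⟩` of the bivector field at `v`. -/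
def bivectorAt (v : Fin n → ℂ) : Cotangent n →ₗ[ℂ] Cotangent n →ₗ[ℂ] ℂ :=
  L.compr₂ (ContinuousLinearMap.apply ℂ ℂ v).toLinearMap

/-- The rank `rk(π₀)`: the maximum over `v` of the rank of `π₀(v)`. -/
def linearRank : ℕ := ⨆ v : Fin n → ℂ, Module.finrank ℂ (LinearMap.range (bivectorAt L v))

/-- The Poisson bracket `{F, G}` of polynomial functions with respect to `π₀`. -/
def polyBracket (F G : MvPolynomial (Fin n) ℂ) (v : Fin n → ℂ) : ℂ :=
  bivectorAt L v (polyD F v) (polyD G v)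

/-- The family `F` of polynomial functions contains an integrable system on `(ℂⁿ, π₀)`: it is
involutive, and `n - rk(π₀) / 2` of its members are independent, i.e. the exterior product of their
differentials is not identically zero. -/
def ContainsIntegrableSystem (F : Fin n → MvPolynomial (Fin n) ℂ) : Prop :=
  (∀ i j v, polyBracket L (F i) (F j) v = 0) ∧
  ∃ s : Finset (Fin n), 2 * s.card + linearRank L = 2 * n ∧
    ∃ v, LinearIndependent ℂ (fun i : s => polyD (F i) v)

end Linear

/-! ### Seeds and (generalized) mutations -/

/-- A (generalized) seed in `ℂ(P)` with exchange set `ex`. An ordinary seed is the case where all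
the multiplicities `mult k` are `1`, and then the strings carry no information. -/
structure Seed {N : ℕ} (V : QuasiAffineVariety N) {n : ℕ} (ex : Finset (Fin n)) where
  /-- The extended cluster. -/
  var : Fin n → V.FunctionField
  /-- The exchange matrix. -/
  mat : Matrix (Fin n) ex ℤ
  /-- The multiplicities. -/
  mult : ex → ℕ
  /-- The strings of coefficients `p_{k,r}`, `0 ≤ r ≤ mult k`: monomials, or more generally
  polynomials, in the frozen variables. -/
  str : ex → ℕ → MvPolynomial {j : Fin n // j ∉ ex} ℂ
  algebraicIndependent : AlgebraicIndependent ℂ var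
  generates : IntermediateField.adjoin ℂ (Set.range var) = ⊤
  skewSymmetrizable : ∃ D : ex → ℤ, (∀ i, 0 < D i) ∧ ∀ i j : ex, D i * mat i j = -(D j * mat j i)
  mult_pos : ∀ k, 0 < mult k
  mult_dvd : ∀ i k : ex, (mult k : ℤ) ∣ mat i k
  str_zero : ∀ k, str k 0 = 1
  str_mult : ∀ k, str k (mult k) = 1

namespace Seed

variable {N : ℕ} {V : QuasiAffineVariety N} {n : ℕ} {ex : Finset (Fin n)}

/-- The frozen variables. -/
def frozen (S : Seed V ex) (j : {j : Fin n // j ∉ ex}) : V.FunctionField := S.var j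

/-- The right-hand side of the generalized exchange relation in direction `k`: with `d = mult k`,
the sum over `0 ≤ r ≤ d` of
`p_{k,r} ∏_{m_{j,k} > 0} φ_j ^ ⌊r m_{j,k} / d⌋ ∏_{m_{j,k} < 0} φ_j ^ ⌊(d - r)(-m_{j,k}) / d⌋`
(the divisions are exact for `j ∈ ex`). -/
def exchange (S : Seed V ex) (k : ex) : V.FunctionField :=
  ∑ r ∈ Finset.range (S.mult k + 1),
    MvPolynomial.aeval S.frozen (S.str k r) *
      ((∏ j, S.var j ^ (r * (S.mat j k).toNat / S.mult k)) *
        ∏ j, S.var j ^ ((S.mult k - r) * (-S.mat j k).toNat / S.mult k))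

/-- For multiplicity one the exchange relation is the ordinary one. -/
theorem exchange_of_mult_eq_one (S : Seed V ex) (k : ex) (hk : S.mult k = 1) :
    S.exchange k = (∏ j with 0 < S.mat j k, S.var j ^ (S.mat j k).toNat) +
      ∏ j with S.mat j k < 0, S.var j ^ (-S.mat j k).toNat := by
  have h1 : S.str k 1 = 1 := by simpa [hk] using S.str_mult k
  have hp : (∏ j with 0 < S.mat j k, S.var j ^ (S.mat j k).toNat) =
      ∏ j, S.var j ^ (S.mat j k).toNat := by
    refine Finset.prod_filter_of_ne fun j _ hj => ?_
    by_contra hle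
    exact hj (by rw [Int.toNat_of_nonpos (not_lt.mp hle), pow_zero])
  have hn : (∏ j with S.mat j k < 0, S.var j ^ (-S.mat j k).toNat) =
      ∏ j, S.var j ^ (-S.mat j k).toNat := by
    refine Finset.prod_filter_of_ne fun j _ hj => ?_
    by_contra hle
    exact hj (by rw [Int.toNat_of_nonpos (by linarith [not_lt.mp hle]), pow_zero])
  rw [hp, hn, exchange, hk]
  simp [Finset.sum_range_succ, S.str_zero, h1, add_comm]

/-- The seed `T` is the (generalized) mutation of the seed `S` in the direction `k`. -/
structure IsMutation (S T : Seed V ex) (k : ex) : Prop where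
  var_ne : ∀ j : Fin n, j ≠ k → T.var j = S.var j
  var_eq : T.var k = S.exchange k / S.var k
  mat_eq : ∀ (i : Fin n) (j : ex), T.mat i j =
    if i = k ∨ j = k then -S.mat i j
    else S.mat i j + (|S.mat i k| * S.mat k j + S.mat i k * |S.mat k j|) / 2
  mult_eq : T.mult = S.mult
  str_ne : ∀ j, j ≠ k → ∀ r ≤ S.mult j, T.str j r = S.str j r
  str_eq : ∀ r ≤ S.mult k, T.str k r = S.str k (S.mult k - r)

/-- The seed `T` is obtained from `S` by a sequence of mutations, i.e. it belongs to the
(generalized) mutation equivalence class of `S`. -/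
def MutEquiv (S T : Seed V ex) : Prop :=
  Relation.ReflTransGen (fun S T : Seed V ex => ∃ k, IsMutation S T k) S T

/-- The mutation class of `S` is regular on `P`: all its cluster variables and frozen variables
are regular functions on `P`. -/
def ClassIsRegular (S : Seed V ex) : Prop := ∀ T, S.MutEquiv T → ∀ j, V.IsRegular (T.var j)

/-- The mutation class of `S` is compatible with `π`: all its extended clusters are log-canonical
with respect to `π`. -/
def ClassIsCompatible (S : Seed V ex) (π : V.PoissonStructure) : Prop :=
  ∀ T, S.MutEquiv T → π.IsLogCanonical T.var

/-- Frozen variable modifications of the mutation class of `S`: families of elements of the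
polynomial algebra in the frozen variables (which are common to all seeds of the class), with
linearly independent differentials, each of which is the product of a Casimir function in `ℂ(P)`
and a monomial in the frozen variables. -/
def IsFrozenModification (S : Seed V ex) (π : V.PoissonStructure)
    (ψ : {j : Fin n // j ∉ ex} → V.FunctionField) : Prop :=
  LinearIndependent V.FunctionField (fun j => KaehlerDifferential.D ℂ V.FunctionField (ψ j)) ∧
  (∀ j, ψ j ∈ Algebra.adjoin ℂ (Set.range S.frozen)) ∧
  ∀ j, ∃ (c : V.FunctionField) (m : {j : Fin n // j ∉ ex} → ℕ),
    π.IsCasimir c ∧ ψ j = c * ∏ i, S.frozen i ^ m i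

/-- The modified extended cluster: the frozen variables are replaced by the `ψ j`. -/
def modified (S : Seed V ex) (ψ : {j : Fin n // j ∉ ex} → V.FunctionField) :
    Fin n → V.FunctionField :=
  fun j => if h : j ∈ ex then S.var j else ψ ⟨j, h⟩

end Seed

end ClusterPoisson

end

open ClusterPoisson

namespace ClusterPoisson

/-! ### Differentials of generators of a purely transcendental extension -/

section Kaehler

variable {k K : Type*} [Field k] [Field K] [Algebra k K]

/-! The differentials of an extended cluster are independent over the function field. The modified
frozen variables are polynomials in the frozen ones with independent differentials, so by counting
dimensions both families of differentials have the same span; hence the modified cluster still has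
independent differentials. Log-canonical brackets survive because Casimirs and monomials respect
them.

A mutation replaces `x` by `E / x`, where `E` does not involve `x`. Modulo the differentials of the
other variables, `d(E/x) = -(E/x²) dx`, while the product of the variables is multiplied by `E/x²`.
The log-volume form therefore only changes sign (`IsMutation.logVolumeForm_modified`).

For involutivity, let `f`, `g` have lowest terms `F`, `G` of degrees `j`, `k`. Since `π` vanishes at
the point, the part of `{f, g}` in degree `j + k - 1` is the linearized bracket of `F` and `G`. But
`{f, g} = c f g` has order at least `j + k`, so this part is zero
(`VanishesAt.leadingBracket_eq_zero`). Orders are handled algebraically through powers of the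
maximal ideal (`OrdAt`) and compared with Taylor expansions by means of local parameters
(`IsParameterSystem`).

For independence, restrict to a generic line `s ↦ s v`. Let the `i`-th member have a lowest term of
degree `e i`. The matrix with rows `s ∂_j f_i` has leading rows `s ^ e i · d_v F_i`, and a form of
lowest degree `d` forces its determinant to have order exactly `∑ e i + d`. If every `n - d` of the
rows `d_v F_i` were dependent, multilinear expansion would leave only terms with at least `d + 1`
remainder rows, so the order would be at least `∑ e i + d + 1` (`isBigO_det_of_dependent`,
`exists_linearIndependent_polyD`). With `d = rk / 2` this gives the required number of independent
lowest terms. -/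

theorem linearIndependent_D_of_algebraicIndependent {n : ℕ} {v : Fin n → K}
    (hv : AlgebraicIndependent k v)
    (hgen : IntermediateField.adjoin k (Set.range v) = ⊤) :
    LinearIndependent K (fun i => KaehlerDifferential.D k K (v i)) := by
  let _ : Algebra (MvPolynomial (Fin n) k) K := (MvPolynomial.aeval v).toAlgebra
  have hmap : ∀ x, algebraMap (MvPolynomial (Fin n) k) K x = MvPolynomial.aeval v x := fun _ => rfl
  have : IsScalarTower k (MvPolynomial (Fin n) k) K :=
    IsScalarTower.of_algebraMap_eq fun x => by
      rw [hmap, MvPolynomial.algebraMap_eq, MvPolynomial.aeval_C]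
  have : FaithfulSMul (MvPolynomial (Fin n) k) K :=
    (faithfulSMul_iff_algebraMap_injective _ _).mpr hv
  have : IsFractionRing (MvPolynomial (Fin n) k) K := IsFractionRing.of_field _ _ fun z => by
    have hz : z ∈ IntermediateField.adjoin k (Set.range v) := hgen ▸ IntermediateField.mem_top
    exact (IntermediateField.mem_adjoin_range_iff k v z).mp hz
  have h := (KaehlerDifferential.mvPolynomialBasis k (Fin n)).linearIndependent
  -- Kähler differentials commute with localization, so the basis `dX_i` over the polynomial ring
  -- stays independent over its fraction field.
  have h' := LinearIndependent.of_isLocalizedModule K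
    (nonZeroDivisors (MvPolynomial (Fin n) k))
    (KaehlerDifferential.map k k (MvPolynomial (Fin n) k) K) h
  have heq : (fun i => KaehlerDifferential.D k K (v i)) =
      KaehlerDifferential.map k k (MvPolynomial (Fin n) k) K ∘
        KaehlerDifferential.mvPolynomialBasis k (Fin n) := by
    funext i
    simp [hmap]
  rw [heq]
  exact h'

theorem D_mem_span_of_mem_adjoin {s : Set K} {f : K} (hf : f ∈ Algebra.adjoin k s) :
    KaehlerDifferential.D k K f ∈ Submodule.span K (KaehlerDifferential.D k K '' s) := by
  induction hf using Algebra.adjoin_induction with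
  | mem x hx => exact Submodule.subset_span ⟨x, hx, rfl⟩
  | algebraMap r => simp
  | add x y _ _ hx hy => rw [map_add]; exact add_mem hx hy
  | mul x y _ _ hx hy =>
    rw [Derivation.leibniz]
    exact add_mem (Submodule.smul_mem _ _ hy) (Submodule.smul_mem _ _ hx)

end Kaehler

/-! ### Linear algebra of wedge products and spans -/

section Exterior

variable {K M : Type*} [Field K] [AddCommGroup M] [Module K M]

/-- Extending the coordinates with respect to `v` to all of `M` and pulling back the determinant
gives an alternating form with value `1` on `v`. -/
theorem ιMulti_ne_zero_of_linearIndependent {n : ℕ} {v : Fin n → M} (hv : LinearIndependent K v) :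
    exteriorPower.ιMulti K n v ≠ 0 := by
  obtain ⟨f, hf⟩ := LinearMap.exists_extend
    ((Finsupp.linearEquivFunOnFinite K K (Fin n)).toLinearMap ∘ₗ hv.repr)
  have hfv : ∀ i, f (v i) = Pi.single i 1 := fun i => by
    have := LinearMap.congr_fun hf ⟨v i, Submodule.subset_span ⟨i, rfl⟩⟩
    simpa [hv.repr_eq_single i] using this
  intro h0
  have := congrArg (exteriorPower.alternatingMapLinearEquiv
    (Matrix.detRowAlternating.compLinearMap f)) h0
  rw [exteriorPower.alternatingMapLinearEquiv_apply_ιMulti, map_zero] at this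
  have h1 : Matrix.of (fun i => f (v i)) = 1 := by
    ext i j
    rw [Matrix.of_apply, hfv, Matrix.one_apply, Pi.single_apply]
    simp only [eq_comm]
  have h2 : Matrix.det (Matrix.of fun i => f (v i)) = 0 := this
  rw [h1, Matrix.det_one] at h2
  exact one_ne_zero h2

/-- The component `u` contributes only terms with a repeated argument. This is the form in which a
mutation acts on a wedge of differentials. -/
theorem AlternatingMap.map_update_add_smul_of_mem_span {N ι : Type*} [AddCommGroup N] [Module K N]
    [DecidableEq ι] (f : M [⋀^ι]→ₗ[K] N) (v : ι → M) (i : ι) (c : K) {u : M}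
    (hu : u ∈ Submodule.span K (v '' {j | j ≠ i})) :
    f (Function.update v i (u + c • v i)) = c • f v := by
  rw [f.map_update_add, f.map_update_smul, Function.update_eq_self]
  suffices f (Function.update v i u) = 0 by rw [this, zero_add]
  induction hu using Submodule.span_induction with
  | mem x hx =>
    obtain ⟨j, hj, rfl⟩ := hx
    exact f.map_update_self v (Ne.symm hj)
  | zero => exact f.map_update_zero v i
  | add x y _ _ hx hy => rw [f.map_update_add, hx, hy, add_zero]
  | smul a x _ hx => rw [f.map_update_smul, hx, smul_zero]

/-- Both families have the same size, so the independent one already exhausts the dimension;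
independence of `v` is not needed. -/
theorem span_range_eq_of_linearIndependent {ι : Type*} [Fintype ι] {u v : ι → M}
    (hu : LinearIndependent K u)
    (h : ∀ i, u i ∈ Submodule.span K (Set.range v)) :
    Submodule.span K (Set.range u) = Submodule.span K (Set.range v) := by
  have : FiniteDimensional K (Submodule.span K (Set.range v)) :=
    FiniteDimensional.span_of_finite K (Set.finite_range v)
  refine Submodule.eq_of_le_of_finrank_le (Submodule.span_le.mpr ?_) ?_
  · rintro _ ⟨i, rfl⟩
    exact h i
  · rw [finrank_span_eq_card hu]
    exact finrank_range_le_card v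

end Exterior

/-! ### Regular functions form a subalgebra -/

namespace QuasiAffineVariety

variable {N : ℕ} (V : QuasiAffineVariety N)

@[simp] theorem ofPoly_add (a b : MvPolynomial (Fin N) ℂ) :
    V.ofPoly (a + b) = V.ofPoly a + V.ofPoly b := by simp [ofPoly]

@[simp] theorem ofPoly_sub (a b : MvPolynomial (Fin N) ℂ) :
    V.ofPoly (a - b) = V.ofPoly a - V.ofPoly b := by simp [ofPoly]

@[simp] theorem ofPoly_mul (a b : MvPolynomial (Fin N) ℂ) :
    V.ofPoly (a * b) = V.ofPoly a * V.ofPoly b := by simp [ofPoly]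

@[simp] theorem ofPoly_one : V.ofPoly 1 = 1 := by simp [ofPoly]

@[simp] theorem ofPoly_zero : V.ofPoly 0 = 0 := by simp [ofPoly]

theorem ofPoly_C (c : ℂ) : V.ofPoly (MvPolynomial.C c) = algebraMap ℂ V.FunctionField c := by
  rw [IsScalarTower.algebraMap_apply ℂ V.CoordRing V.FunctionField]
  rfl

variable {V}

theorem ofPoly_eq_zero_iff {a : MvPolynomial (Fin N) ℂ} : V.ofPoly a = 0 ↔ a ∈ V.ideal := by
  rw [ofPoly, map_eq_zero_iff _ (IsFractionRing.injective V.CoordRing V.FunctionField),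
    Ideal.Quotient.eq_zero_iff_mem]

theorem ofPoly_ne_zero {p : Fin N → ℂ} (hp : p ∈ V.carrier) {b : MvPolynomial (Fin N) ℂ}
    (hb : MvPolynomial.eval p b ≠ 0) : V.ofPoly b ≠ 0 := by
  intro h
  exact hb (by simpa using MvPolynomial.mem_vanishingIdeal_iff.mp (ofPoly_eq_zero_iff.mp h) p hp)

theorem exists_ofPoly_div (f : V.FunctionField) :
    ∃ a b, V.ofPoly b ≠ 0 ∧ f = V.ofPoly a / V.ofPoly b := by
  obtain ⟨x, y, hy, rfl⟩ := IsFractionRing.div_surjective (A := V.CoordRing) f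
  obtain ⟨a, rfl⟩ := Ideal.Quotient.mk_surjective x
  obtain ⟨b, rfl⟩ := Ideal.Quotient.mk_surjective y
  refine ⟨a, b, ?_, rfl⟩
  simpa [ofPoly] using nonZeroDivisors.ne_zero hy

theorem regularAt_ofPoly (a : MvPolynomial (Fin N) ℂ) (p : Fin N → ℂ) : V.RegularAt (V.ofPoly a) p :=
  ⟨(a, 1), by simp, by simp⟩

theorem RegularAt.add {p : Fin N → ℂ} (hp : p ∈ V.carrier) {f g : V.FunctionField}
    (hf : V.RegularAt f p) (hg : V.RegularAt g p) : V.RegularAt (f + g) p := by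
  obtain ⟨⟨a, b⟩, hb, rfl⟩ := hf
  obtain ⟨⟨c, d⟩, hd, rfl⟩ := hg
  refine ⟨(a * d + b * c, b * d), by simpa using ⟨hb, hd⟩, ?_⟩
  simp only [ofPoly_add, ofPoly_mul]
  exact div_add_div _ _ (ofPoly_ne_zero hp hb) (ofPoly_ne_zero hp hd)

theorem RegularAt.mul {p : Fin N → ℂ} {f g : V.FunctionField}
    (hf : V.RegularAt f p) (hg : V.RegularAt g p) : V.RegularAt (f * g) p := by
  obtain ⟨⟨a, b⟩, hb, rfl⟩ := hf
  obtain ⟨⟨c, d⟩, hd, rfl⟩ := hg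
  refine ⟨(a * c, b * d), by simpa using ⟨hb, hd⟩, ?_⟩
  simp only [ofPoly_mul, div_mul_div_comm]

theorem regularAt_algebraMap (c : ℂ) (p : Fin N → ℂ) :
    V.RegularAt (algebraMap ℂ V.FunctionField c) p := by
  rw [← ofPoly_C]
  exact regularAt_ofPoly _ p

theorem isRegular_of_mem_adjoin {s : Set V.FunctionField} (hs : ∀ f ∈ s, V.IsRegular f)
    {f : V.FunctionField} (hf : f ∈ Algebra.adjoin ℂ s) : V.IsRegular f := by
  intro p hp
  induction hf using Algebra.adjoin_induction with
  | mem x hx => exact hs x hx p hp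
  | algebraMap r => exact regularAt_algebraMap r p
  | add x y _ _ hx hy => exact hx.add hp hy
  | mul x y _ _ hx hy => exact hx.mul hy

/-! ### Brackets -/

namespace PoissonStructure

variable (π : V.PoissonStructure)

theorem bracket_swap (f g : V.FunctionField) : π.bracket g f = -π.bracket f g := by
  have h := π.bracket_self (f + g)
  simp only [map_add, LinearMap.add_apply, π.bracket_self] at h
  linear_combination h

theorem bracket_one (f : V.FunctionField) : π.bracket f 1 = 0 := by
  have h := π.leibniz f 1 1
  rw [mul_one, mul_one, one_mul] at h
  linear_combination -h

/-- Having a log-canonical Poisson bracket. -/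
def LogCan (f g : V.FunctionField) : Prop := ∃ c : ℂ, π.bracket f g = c • (f * g)

variable {π}

theorem LogCan.symm {f g : V.FunctionField} (h : π.LogCan f g) : π.LogCan g f := by
  obtain ⟨c, hc⟩ := h
  exact ⟨-c, by rw [π.bracket_swap, hc, neg_smul, mul_comm]⟩

theorem LogCan.mul_right {f g h : V.FunctionField} (hg : π.LogCan f g) (hh : π.LogCan f h) :
    π.LogCan f (g * h) := by
  obtain ⟨c, hc⟩ := hg
  obtain ⟨d, hd⟩ := hh
  refine ⟨c + d, ?_⟩
  rw [π.leibniz, hc, hd]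
  simp only [Algebra.smul_def, map_add]
  ring

theorem logCan_one (f : V.FunctionField) : π.LogCan f 1 := ⟨0, by simp [π.bracket_one]⟩

theorem LogCan.pow_right {f g : V.FunctionField} (hg : π.LogCan f g) (m : ℕ) :
    π.LogCan f (g ^ m) := by
  induction m with
  | zero => simpa using logCan_one f
  | succ m ih => rw [pow_succ]; exact ih.mul_right hg

theorem LogCan.prod_right {ι : Type*} {f : V.FunctionField} (s : Finset ι) (g : ι → V.FunctionField)
    (h : ∀ i ∈ s, π.LogCan f (g i)) : π.LogCan f (∏ i ∈ s, g i) := by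
  classical
  induction s using Finset.induction_on with
  | empty => simpa using logCan_one f
  | insert i s hi ih =>
    rw [Finset.prod_insert hi]
    exact (h i (Finset.mem_insert_self i s)).mul_right
      (ih fun j hj => h j (Finset.mem_insert_of_mem hj))

theorem IsCasimir.logCan {c : V.FunctionField} (hc : π.IsCasimir c) (f : V.FunctionField) :
    π.LogCan f c := ⟨0, by rw [π.bracket_swap, hc, neg_zero, zero_smul]⟩

end PoissonStructure

end QuasiAffineVariety

/-! ### Modified extended clusters -/

namespace Seed

open QuasiAffineVariety PoissonStructure

variable {N : ℕ} {V : QuasiAffineVariety N} {n : ℕ} {ex : Finset (Fin n)}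

theorem MutEquiv.frozen_eq {S T : Seed V ex} (h : S.MutEquiv T) : T.frozen = S.frozen := by
  induction h with
  | refl => rfl
  | tail _ hk ih =>
    obtain ⟨k, hk⟩ := hk
    rw [← ih]
    funext j
    exact hk.var_ne j fun h => j.2 (h ▸ k.2)

/-- The condition sees a seed only through its frozen variables, which mutations in exchangeable
directions leave alone. -/
theorem IsFrozenModification.of_mutEquiv {S T : Seed V ex} {π : V.PoissonStructure}
    {ψ : {j : Fin n // j ∉ ex} → V.FunctionField} (hψ : S.IsFrozenModification π ψ)
    (h : S.MutEquiv T) : T.IsFrozenModification π ψ := by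
  unfold IsFrozenModification at hψ ⊢
  rwa [h.frozen_eq]

theorem modified_of_mem (S : Seed V ex) (ψ : {j : Fin n // j ∉ ex} → V.FunctionField) {j : Fin n}
    (hj : j ∈ ex) : S.modified ψ j = S.var j := dif_pos hj

theorem modified_of_notMem (S : Seed V ex) (ψ : {j : Fin n // j ∉ ex} → V.FunctionField) {j : Fin n}
    (hj : j ∉ ex) : S.modified ψ j = ψ ⟨j, hj⟩ := dif_neg hj

theorem linearIndependent_D_var (S : Seed V ex) :
    LinearIndependent V.FunctionField
      (fun i => KaehlerDifferential.D ℂ V.FunctionField (S.var i)) :=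
  linearIndependent_D_of_algebraicIndependent S.algebraicIndependent S.generates

section

variable {S : Seed V ex} {π : V.PoissonStructure} {ψ : {j : Fin n // j ∉ ex} → V.FunctionField}

/-- The differential of a polynomial in the frozen variables is a combination of theirs, which gives
one inclusion; independence and equal cardinality give the other. -/
theorem IsFrozenModification.span_D_eq (hψ : S.IsFrozenModification π ψ) :
    Submodule.span V.FunctionField
        (Set.range fun j => KaehlerDifferential.D ℂ V.FunctionField (ψ j)) =
      Submodule.span V.FunctionField
        (Set.range fun j => KaehlerDifferential.D ℂ V.FunctionField (S.frozen j)) := by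
  refine span_range_eq_of_linearIndependent hψ.1 fun j => ?_
  have := D_mem_span_of_mem_adjoin (hψ.2.1 j)
  rwa [← Set.range_comp] at this

/-- The set `s` is kept general for two uses: all indices, for independence of the modified cluster,
and all indices except the mutation direction, for the mutation formula. -/
theorem IsFrozenModification.D_var_mem_span (hψ : S.IsFrozenModification π ψ) {s : Set (Fin n)}
    (hs : ∀ j, j ∉ ex → j ∈ s) {j : Fin n} (hj : j ∈ s) :
    KaehlerDifferential.D ℂ V.FunctionField (S.var j) ∈ Submodule.span V.FunctionField
      ((fun i => KaehlerDifferential.D ℂ V.FunctionField (S.modified ψ i)) '' s) := by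
  by_cases hex : j ∈ ex
  · rw [← S.modified_of_mem ψ hex]
    exact Submodule.subset_span ⟨j, hj, rfl⟩
  · have h : KaehlerDifferential.D ℂ V.FunctionField (S.var j) ∈ Submodule.span V.FunctionField
        (Set.range fun j => KaehlerDifferential.D ℂ V.FunctionField (S.frozen j)) :=
      Submodule.subset_span ⟨⟨j, hex⟩, rfl⟩
    rw [← hψ.span_D_eq] at h
    refine Submodule.span_mono ?_ h
    rintro _ ⟨i, rfl⟩
    exact ⟨i, hs i i.2, by simp only [S.modified_of_notMem ψ i.2]⟩

/-- The `n` modified differentials span a space containing the `n` independent differentials of the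
cluster. -/
theorem IsFrozenModification.linearIndependent_D_modified (hψ : S.IsFrozenModification π ψ) :
    LinearIndependent V.FunctionField
      (fun i => KaehlerDifferential.D ℂ V.FunctionField (S.modified ψ i)) := by
  rw [linearIndependent_iff_card_le_finrank_span, ← finrank_span_eq_card S.linearIndependent_D_var]
  have : FiniteDimensional V.FunctionField (Submodule.span V.FunctionField
      (Set.range fun i => KaehlerDifferential.D ℂ V.FunctionField (S.modified ψ i))) :=
    FiniteDimensional.span_of_finite _ (Set.finite_range _)
  refine Submodule.finrank_mono (Submodule.span_le.mpr ?_)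
  rintro _ ⟨j, rfl⟩
  simpa using hψ.D_var_mem_span (s := Set.univ) (fun _ _ => trivial) (Set.mem_univ j)

theorem IsFrozenModification.wedgeD_modified_ne_zero (hψ : S.IsFrozenModification π ψ) :
    V.wedgeD (S.modified ψ) ≠ 0 :=
  ιMulti_ne_zero_of_linearIndependent hψ.linearIndependent_D_modified

theorem IsFrozenModification.modified_ne_zero (hψ : S.IsFrozenModification π ψ) (i : Fin n) :
    S.modified ψ i ≠ 0 := fun h =>
  hψ.linearIndependent_D_modified.ne_zero i (by simp [h])

/-- Only one argument of the bracket is modified here; antisymmetry and a second application handle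
the other. -/
theorem IsFrozenModification.logCan_modified (hψ : S.IsFrozenModification π ψ)
    {f : V.FunctionField} (hf : ∀ j, π.LogCan f (S.var j))
    (j : Fin n) : π.LogCan f (S.modified ψ j) := by
  by_cases hj : j ∈ ex
  · rw [S.modified_of_mem ψ hj]
    exact hf j
  · rw [S.modified_of_notMem ψ hj]
    obtain ⟨c, m, hc, h⟩ := hψ.2.2 ⟨j, hj⟩
    rw [h]
    exact (hc.logCan f).mul_right (LogCan.prod_right _ _ fun i _ => (hf i).pow_right _)

theorem IsFrozenModification.isLogCanonical_modified (hψ : S.IsFrozenModification π ψ)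
    (hS : π.IsLogCanonical S.var) : π.IsLogCanonical (S.modified ψ) := fun i j =>
  hψ.logCan_modified (fun k => (hψ.logCan_modified (fun l => hS k l) i).symm) j

end

/-! ### Mutations and the log-volume form -/

theorem mat_self (S : Seed V ex) (k : ex) : S.mat k k = 0 := by
  obtain ⟨D, hD, h⟩ := S.skewSymmetrizable
  have h1 := h k k
  have h2 : D k * S.mat k k = 0 := by linarith
  exact (mul_eq_zero.mp h2).resolve_left (hD k).ne'

/-- The diagonal entry of the exchange matrix is zero, so the variable being mutated occurs with
exponent zero; the string coefficients involve frozen variables only. -/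
theorem exchange_mem_adjoin (S : Seed V ex) (k : ex) :
    S.exchange k ∈ Algebra.adjoin ℂ (S.var '' {j | j ≠ k}) := by
  have hvar : ∀ (j : Fin n) (m : ℕ), (j = k → m = 0) →
      S.var j ^ m ∈ Algebra.adjoin ℂ (S.var '' {j | j ≠ k}) := fun j m hm => by
    by_cases hj : j = k
    · rw [hm hj, pow_zero]
      exact one_mem _
    · exact pow_mem (Algebra.subset_adjoin (Set.mem_image_of_mem S.var hj)) m
  refine sum_mem fun r _ => mul_mem ?_ (mul_mem (prod_mem fun j _ => hvar j _ ?_)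
    (prod_mem fun j _ => hvar j _ ?_))
  · have h : MvPolynomial.aeval S.frozen (S.str k r) ∈ Algebra.adjoin ℂ (Set.range S.frozen) := by
      rw [Algebra.adjoin_range_eq_range_aeval]
      exact AlgHom.mem_range_self _ _
    refine Algebra.adjoin_mono ?_ h
    rintro _ ⟨j, rfl⟩
    exact ⟨j, fun h => j.2 (h ▸ k.2), rfl⟩
  · rintro rfl
    simp [S.mat_self k]
  · rintro rfl
    simp [S.mat_self k]

variable {S T : Seed V ex} {π : V.PoissonStructure} {ψ : {j : Fin n // j ∉ ex} → V.FunctionField}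

/-- With `x` the old variable and `E` the exchange expression, the wedge is multiplied by `-(E/x²)`
and the product of the members by `E/x²`. -/
theorem IsMutation.logVolumeForm_modified {k : ex} (h : IsMutation S T k)
    (hψ : S.IsFrozenModification π ψ) :
    V.logVolumeForm (T.modified ψ) = -V.logVolumeForm (S.modified ψ) := by
  have hx : S.var k ≠ 0 := S.algebraicIndependent.ne_zero k
  have hE : S.exchange k ≠ 0 := by
    have := T.algebraicIndependent.ne_zero k
    rw [h.var_eq] at this
    exact (div_ne_zero_iff.mp this).1
  have hmod : T.modified ψ = Function.update (S.modified ψ) k (S.exchange k / S.var k) := by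
    funext j
    rcases eq_or_ne j k with rfl | hj
    · rw [Function.update_self, T.modified_of_mem ψ k.2, h.var_eq]
    · rw [Function.update_of_ne hj, modified, modified, h.var_ne j hj]
  have hD : (fun i => KaehlerDifferential.D ℂ V.FunctionField (T.modified ψ i)) =
      Function.update (fun i => KaehlerDifferential.D ℂ V.FunctionField (S.modified ψ i)) k
        ((S.var k)⁻¹ • KaehlerDifferential.D ℂ V.FunctionField (S.exchange k) +
          (-(S.exchange k / S.var k ^ 2)) •
            KaehlerDifferential.D ℂ V.FunctionField (S.modified ψ k)) := by
    funext j
    rw [hmod]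
    rcases eq_or_ne j k with rfl | hj
    · rw [Function.update_self, Function.update_self, Derivation.leibniz_div,
        S.modified_of_mem ψ k.2, smul_sub, smul_smul, smul_smul, sub_eq_add_neg, ← neg_smul]
      congr 2 <;> field_simp
    · rw [Function.update_of_ne hj, Function.update_of_ne hj]
  -- This summand of `d(E/x)` dies in the wedge: `E` is a polynomial in the other variables, and
  -- deleting the exchangeable index `k` keeps all frozen indices.
  have hu : (S.var k)⁻¹ • KaehlerDifferential.D ℂ V.FunctionField (S.exchange k) ∈
      Submodule.span V.FunctionField
        ((fun i => KaehlerDifferential.D ℂ V.FunctionField (S.modified ψ i)) ''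
          {j | j ≠ (k : Fin n)}) := by
    refine Submodule.smul_mem _ _ ?_
    refine Submodule.span_le.mpr ?_ (D_mem_span_of_mem_adjoin (S.exchange_mem_adjoin k))
    rintro _ ⟨_, ⟨j, hj, rfl⟩, rfl⟩
    exact hψ.D_var_mem_span (s := {j | j ≠ (k : Fin n)}) (fun i hi hik => hi (hik ▸ k.2)) hj
  have hwedge : V.wedgeD (T.modified ψ) =
      (-(S.exchange k / S.var k ^ 2)) • V.wedgeD (S.modified ψ) := by
    rw [wedgeD, hD, AlternatingMap.map_update_add_smul_of_mem_span _ _ _ _ hu]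
    rfl
  have hprod : ∏ i, T.modified ψ i =
      (S.exchange k / S.var k ^ 2) * ∏ i, S.modified ψ i := by
    rw [hmod, Finset.prod_update_of_mem (Finset.mem_univ _),
      ← Finset.mul_prod_erase Finset.univ (S.modified ψ) (Finset.mem_univ (k : Fin n)),
      S.modified_of_mem ψ k.2, Finset.sdiff_singleton_eq_erase]
    field_simp
  rw [logVolumeForm, logVolumeForm, hwedge, hprod, smul_smul]
  have : S.exchange k / S.var k ^ 2 ≠ 0 := div_ne_zero hE (pow_ne_zero 2 hx)
  rw [mul_inv, mul_neg, mul_right_comm, inv_mul_cancel₀ this, one_mul]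
  exact neg_smul _ _

theorem MutEquiv.logVolumeForm_modified (h : S.MutEquiv T) (hψ : S.IsFrozenModification π ψ) :
    V.logVolumeForm (T.modified ψ) = V.logVolumeForm (S.modified ψ) ∨
      V.logVolumeForm (T.modified ψ) = -V.logVolumeForm (S.modified ψ) := by
  induction h with
  | refl => exact Or.inl rfl
  | tail hST hk ih =>
    obtain ⟨k, hk⟩ := hk
    rw [hk.logVolumeForm_modified (hψ.of_mutEquiv hST)]
    rcases ih with ih | ih
    · exact Or.inr (by rw [ih])
    · exact Or.inl (by rw [ih, neg_neg])

end Seed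

end ClusterPoisson

namespace ClusterPoisson

/-! ### Polynomials near a point of affine space -/

section PointIdeal

variable {N : ℕ}

/-- The ideal of the polynomials that vanish at `p`. -/
noncomputable def pointIdeal (p : Fin N → ℂ) : Ideal (MvPolynomial (Fin N) ℂ) := RingHom.ker (MvPolynomial.eval p)

variable {p : Fin N → ℂ}

theorem mem_pointIdeal {a : MvPolynomial (Fin N) ℂ} :
    a ∈ pointIdeal p ↔ MvPolynomial.eval p a = 0 := RingHom.mem_ker

theorem X_sub_C_mem_pointIdeal (k : Fin N) :
    MvPolynomial.X k - MvPolynomial.C (p k) ∈ pointIdeal p := by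
  simp [mem_pointIdeal]

theorem sub_C_eval_mem_pointIdeal (a : MvPolynomial (Fin N) ℂ) :
    a - MvPolynomial.C (MvPolynomial.eval p a) ∈ pointIdeal p := by
  simp [mem_pointIdeal]

/-- The differential at `p` of a polynomial function, as a linear form on the ambient space. -/
noncomputable def diffAt (p : Fin N → ℂ) : MvPolynomial (Fin N) ℂ →ₗ[ℂ] Module.Dual ℂ (Fin N → ℂ) where
  toFun a := ∑ i : Fin N, MvPolynomial.eval p (MvPolynomial.pderiv i a) •
    (LinearMap.proj i : (Fin N → ℂ) →ₗ[ℂ] ℂ)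
  map_add' a b := by simp [add_smul, Finset.sum_add_distrib]
  map_smul' c a := by simp [Finset.smul_sum, smul_smul, MvPolynomial.smul_eval]

theorem diffAt_apply (a : MvPolynomial (Fin N) ℂ) (v : Fin N → ℂ) :
    diffAt p a v = ∑ i, MvPolynomial.eval p (MvPolynomial.pderiv i a) * v i := by
  simp [diffAt]

theorem diffAt_single (a : MvPolynomial (Fin N) ℂ) (i : Fin N) :
    diffAt p a (Pi.single i 1) = MvPolynomial.eval p (MvPolynomial.pderiv i a) := by
  simp [diffAt_apply, Pi.single_apply]

/-- In the product step, the remainder of `a X_j` is `(a - a(p)) (X_j - p_j)`, a product of two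
elements of the maximal ideal, plus `p_j` times the remainder of `a`. -/
theorem sub_taylor_mem_pointIdeal_sq (a : MvPolynomial (Fin N) ℂ) :
    a - MvPolynomial.C (MvPolynomial.eval p a) -
      ∑ k, MvPolynomial.C (MvPolynomial.eval p (MvPolynomial.pderiv k a)) *
        (MvPolynomial.X k - MvPolynomial.C (p k)) ∈ pointIdeal p ^ 2 := by
  induction a using MvPolynomial.induction_on with
  | C c => simp
  | add a b ha hb =>
    convert! add_mem ha hb using 1
    simp only [map_add, add_mul, Finset.sum_add_distrib]
    ring
  | mul_X a j ha =>
    have h1 : (a - MvPolynomial.C (MvPolynomial.eval p a)) *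
        (MvPolynomial.X j - MvPolynomial.C (p j)) ∈ pointIdeal p ^ 2 := by
      rw [pow_two]
      exact Ideal.mul_mem_mul (sub_C_eval_mem_pointIdeal a) (X_sub_C_mem_pointIdeal j)
    convert! add_mem h1 (Ideal.mul_mem_left _ (MvPolynomial.C (p j)) ha) using 1
    simp only [Derivation.leibniz, MvPolynomial.pderiv_X, smul_eq_mul, map_add, map_mul,
      MvPolynomial.eval_X, add_mul, Finset.sum_add_distrib]
    have h2 : ∑ k, MvPolynomial.C (MvPolynomial.eval p a) *
        MvPolynomial.C (MvPolynomial.eval p (Pi.single (M := fun _ => MvPolynomial (Fin N) ℂ) j 1 k)) *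
          (MvPolynomial.X k - MvPolynomial.C (p k)) =
        MvPolynomial.C (MvPolynomial.eval p a) * (MvPolynomial.X j - MvPolynomial.C (p j)) := by
      rw [Finset.sum_eq_single j]
      · simp
      · intro b _ hb
        simp [Pi.single_eq_of_ne hb]
      · simp
    simp only [Pi.single_apply] at h2 ⊢
    rw [mul_sub, mul_sub, Finset.mul_sum]
    simp only [← mul_assoc] at h2 ⊢
    simp only [eq_comm (a := j)] at h2 ⊢
    rw [h2]
    ring

theorem mem_pointIdeal_sq {a : MvPolynomial (Fin N) ℂ} (h0 : MvPolynomial.eval p a = 0)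
    (h1 : diffAt p a = 0) : a ∈ pointIdeal p ^ 2 := by
  have h := sub_taylor_mem_pointIdeal_sq (p := p) a
  simpa [h0, ← diffAt_single, h1] using h

theorem hasFDerivAt_eval (a : MvPolynomial (Fin N) ℂ) (q : Fin N → ℂ) :
    HasFDerivAt (fun z => MvPolynomial.eval z a) (diffAt q a).toContinuousLinearMap q := by
  induction a using MvPolynomial.induction_on with
  | C c =>
    have h : (diffAt q (MvPolynomial.C c)).toContinuousLinearMap = 0 := by
      ext v
      simp [diffAt_apply]
    rw [h]
    simpa using hasFDerivAt_const c q
  | add a b ha hb =>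
    refine ((ha.add hb).congr_fderiv ?_).congr_of_eventuallyEq (.of_forall fun z => by simp)
    ext v
    simp
  | mul_X a j ha =>
    refine ((ha.mul (hasFDerivAt_apply (𝕜 := ℂ) j q)).congr_fderiv ?_).congr_of_eventuallyEq
      (.of_forall fun z => by simp)
    ext v
    simp only [LinearMap.coe_toContinuousLinearMap', diffAt_apply, Derivation.leibniz,
      MvPolynomial.pderiv_X, smul_eq_mul, map_add, map_mul, MvPolynomial.eval_X, add_mul,
      Finset.sum_add_distrib, add_apply, smul_apply,
      ContinuousLinearMap.proj_apply, Finset.mul_sum, mul_assoc]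
    congr 1
    rw [Finset.sum_eq_single j]
    · simp
    · intro b _ hb
      simp [Pi.single_eq_of_ne hb.symm]
    · simp

theorem analyticAt_eval (a : MvPolynomial (Fin N) ℂ) (q : Fin N → ℂ) :
    AnalyticAt ℂ (fun z => MvPolynomial.eval z a) q := by
  have := AnalyticAt.aeval_mvPolynomial (𝕜 := ℂ) (f := fun z : Fin N → ℂ => z) (z := q)
    (fun i => (ContinuousLinearMap.proj (R := ℂ) (φ := fun _ : Fin N => ℂ) i).analyticAt q) a
  simpa [MvPolynomial.aeval_eq_eval] using this

/-- Substitution by elements of the maximal ideal maps the ideal of the variables into it, hence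
respects powers. -/
theorem bind₁_mem_pow {n k : ℕ} {t : Fin n → MvPolynomial (Fin N) ℂ}
    (ht : ∀ i, t i ∈ pointIdeal p) {F : MvPolynomial (Fin n) ℂ} (hF : F.IsHomogeneous k) :
    MvPolynomial.bind₁ t F ∈ pointIdeal p ^ k := by
  have hmem : F ∈ MvPolynomial.idealOfVars (Fin n) ℂ ^ k := by
    rw [MvPolynomial.mem_pow_idealOfVars_iff]
    intro x hx
    rw [Finsupp.degree_eq_weight_one]
    exact (hF (MvPolynomial.mem_support_iff.mp hx)).ge
  have hle : Ideal.map (MvPolynomial.bind₁ t).toRingHom (MvPolynomial.idealOfVars (Fin n) ℂ) ≤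
      pointIdeal p := by
    rw [MvPolynomial.idealOfVars, Ideal.map_span, Ideal.span_le]
    rintro _ ⟨_, ⟨i, rfl⟩, rfl⟩
    simpa using ht i
  have := Ideal.mem_map_of_mem (MvPolynomial.bind₁ t).toRingHom hmem
  rw [Ideal.map_pow] at this
  exact Ideal.pow_right_mono hle k this

/-- If the `t i` span the cotangent space of an ideal `I` at `p`, then modulo `I` the elements of
`𝔪 ^ k` have a leading form of degree `k` in the `t i`. -/
theorem exists_leadingForm {n : ℕ} {t : Fin n → MvPolynomial (Fin N) ℂ}
    {I : Ideal (MvPolynomial (Fin N) ℂ)} (ht : ∀ i, t i ∈ pointIdeal p)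
    (hspan : ∀ a ∈ pointIdeal p, ∃ c : Fin n → ℂ,
      a - ∑ i, MvPolynomial.C (c i) * t i ∈ pointIdeal p ^ 2 ⊔ I)
    (k : ℕ) {a : MvPolynomial (Fin N) ℂ} (ha : a ∈ pointIdeal p ^ k) :
    ∃ F : MvPolynomial (Fin n) ℂ, F.IsHomogeneous k ∧
      a - MvPolynomial.bind₁ t F ∈ pointIdeal p ^ (k + 1) ⊔ I := by
  induction k generalizing a with
  | zero =>
    refine ⟨MvPolynomial.C (MvPolynomial.eval p a), MvPolynomial.isHomogeneous_C _ _, ?_⟩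
    refine Ideal.mem_sup_left ?_
    simpa using sub_C_eval_mem_pointIdeal a
  | succ k ih =>
    rw [pow_succ'] at ha
    refine Submodule.mul_induction_on ha (fun x hx y hy => ?_) fun x y hx hy => ?_
    · obtain ⟨c, hc⟩ := hspan x hx
      obtain ⟨G, hG, hyG⟩ := ih hy
      set l : MvPolynomial (Fin n) ℂ := ∑ i, MvPolynomial.C (c i) * MvPolynomial.X i with hl
      have hlhom : l.IsHomogeneous 1 := MvPolynomial.IsHomogeneous.sum _ _ _ fun i _ => by
        simpa using (MvPolynomial.isHomogeneous_C _ (c i)).mul (MvPolynomial.isHomogeneous_X ℂ i)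
      have hbl : MvPolynomial.bind₁ t l = ∑ i, MvPolynomial.C (c i) * t i := by
        simp [hl]
      refine ⟨l * G, by simpa [add_comm] using hlhom.mul hG, ?_⟩
      -- Leading forms multiply: in each summand one factor is a remainder and gains one order,
      -- while the other has its expected order.
      rw [map_mul, show x * y - MvPolynomial.bind₁ t l * MvPolynomial.bind₁ t G =
        (x - MvPolynomial.bind₁ t l) * y +
          MvPolynomial.bind₁ t l * (y - MvPolynomial.bind₁ t G) by ring]
      rw [← hbl] at hc
      refine add_mem ?_ ?_
      · obtain ⟨u, hu, w, hw, huw⟩ := Submodule.mem_sup.mp hc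
        rw [← huw, add_mul]
        refine add_mem (Ideal.mem_sup_left ?_) (Ideal.mem_sup_right (Ideal.mul_mem_right _ _ hw))
        rw [show k + 1 + 1 = 2 + k by ring, pow_add]
        exact Ideal.mul_mem_mul hu hy
      · obtain ⟨u, hu, w, hw, huw⟩ := Submodule.mem_sup.mp hyG
        rw [← huw, mul_add]
        refine add_mem (Ideal.mem_sup_left ?_) (Ideal.mem_sup_right (Ideal.mul_mem_left _ _ hw))
        rw [pow_succ' _ (k + 1)]
        refine Ideal.mul_mem_mul ?_ hu
        simpa using bind₁_mem_pow ht hlhom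
    · obtain ⟨F, hF, hxF⟩ := hx
      obtain ⟨G, hG, hyG⟩ := hy
      refine ⟨F + G, hF.add hG, ?_⟩
      rw [map_add, add_sub_add_comm]
      exact add_mem hxF hyG

/-- Krull's intersection theorem for a prime ideal contained in the ideal of a point. -/
theorem exists_mem_pow_sup_not_mem {I : Ideal (MvPolynomial (Fin N) ℂ)} [I.IsPrime]
    (hI : I ≤ pointIdeal p) {a : MvPolynomial (Fin N) ℂ} (ha : a ∉ I) :
    ∃ k, a ∈ pointIdeal p ^ k ⊔ I ∧ a ∉ pointIdeal p ^ (k + 1) ⊔ I := by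
  set J := Ideal.map (Ideal.Quotient.mk I) (pointIdeal p) with hJ
  have hmem : ∀ k, Ideal.Quotient.mk I a ∈ J ^ k ↔ a ∈ pointIdeal p ^ k ⊔ I := fun k => by
    rw [hJ, ← Ideal.map_pow, Ideal.mem_quotient_iff_mem_sup]
  have hne : J ≠ ⊤ := by
    rw [Ideal.ne_top_iff_one, hJ, ← map_one (Ideal.Quotient.mk I), Ideal.mem_quotient_iff_mem_sup,
      sup_eq_left.mpr hI, mem_pointIdeal]
    simp
  -- The coordinate ring is a Noetherian domain, and the image of the maximal ideal is proper
  -- because `I` is contained in it.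
  have hK := Ideal.iInf_pow_eq_bot_of_isDomain J hne
  have hex : ∃ k, a ∉ pointIdeal p ^ k ⊔ I := by
    by_contra! hall
    have h0 : Ideal.Quotient.mk I a ∈ ⨅ k, J ^ k := by
      simp only [Submodule.mem_iInf]
      exact fun k => (hmem k).mpr (hall k)
    rw [hK, Ideal.mem_bot, Ideal.Quotient.eq_zero_iff_mem] at h0
    exact ha h0
  classical
  -- The wanted `k` is the predecessor of the first failing exponent, which is positive because the
  -- zeroth power is the whole ring.
  have hpos : Nat.find hex ≠ 0 := fun h0 => by
    have := Nat.find_spec hex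
    rw [h0, pow_zero, Ideal.one_eq_top, top_sup_eq] at this
    exact this trivial
  obtain ⟨k, hk⟩ := Nat.exists_eq_succ_of_ne_zero hpos
  refine ⟨k, ?_, ?_⟩
  · have := Nat.find_min hex (m := k) (by omega)
    simpa using this
  · have := Nat.find_spec hex
    rwa [hk] at this

end PointIdeal

end ClusterPoisson

namespace ClusterPoisson

namespace QuasiAffineVariety

variable {N : ℕ} {V : QuasiAffineVariety N} {p : Fin N → ℂ}

/-! ### Orders of vanishing at a point -/

variable (V) in
/-- The rational function `f` lies in the `k`-th power of the maximal ideal of the local ring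
at `p`. -/
def OrdAt (p : Fin N → ℂ) (k : ℕ) (f : V.FunctionField) : Prop :=
  ∃ a b, a ∈ pointIdeal p ^ k ∧ MvPolynomial.eval p b ≠ 0 ∧ f = V.ofPoly a / V.ofPoly b

theorem OrdAt.regularAt {k : ℕ} {f : V.FunctionField} (hf : V.OrdAt p k f) : V.RegularAt f p := by
  obtain ⟨a, b, -, hb, rfl⟩ := hf
  exact ⟨(a, b), hb, rfl⟩

theorem RegularAt.ordAt {f : V.FunctionField} (hf : V.RegularAt f p) : V.OrdAt p 0 f := by
  obtain ⟨⟨a, b⟩, hb, rfl⟩ := hf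
  exact ⟨a, b, by simp, hb, rfl⟩

theorem OrdAt.mono {j k : ℕ} (hjk : j ≤ k) {f : V.FunctionField} (hf : V.OrdAt p k f) :
    V.OrdAt p j f := by
  obtain ⟨a, b, ha, hb, rfl⟩ := hf
  exact ⟨a, b, Ideal.pow_le_pow_right hjk ha, hb, rfl⟩

theorem ordAt_div {k : ℕ} {a b : MvPolynomial (Fin N) ℂ} (ha : a ∈ pointIdeal p ^ k ⊔ V.ideal)
    (hb : MvPolynomial.eval p b ≠ 0) : V.OrdAt p k (V.ofPoly a / V.ofPoly b) := by
  obtain ⟨u, hu, w, hw, rfl⟩ := Submodule.mem_sup.mp ha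
  exact ⟨u, b, hu, hb, by rw [ofPoly_add, ofPoly_eq_zero_iff.mpr hw, add_zero]⟩

theorem ordAt_ofPoly {k : ℕ} {a : MvPolynomial (Fin N) ℂ} (ha : a ∈ pointIdeal p ^ k ⊔ V.ideal) :
    V.OrdAt p k (V.ofPoly a) := by
  simpa using ordAt_div ha (b := 1) (by simp)

theorem ordAt_zero (k : ℕ) : V.OrdAt p k 0 := by
  simpa using ordAt_ofPoly (V := V) (p := p) (k := k) (zero_mem _)

theorem OrdAt.mul {j k : ℕ} {f g : V.FunctionField} (hf : V.OrdAt p j f) (hg : V.OrdAt p k g) :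
    V.OrdAt p (j + k) (f * g) := by
  obtain ⟨a, b, ha, hb, rfl⟩ := hf
  obtain ⟨c, d, hc, hd, rfl⟩ := hg
  refine ⟨a * c, b * d, ?_, by simpa using ⟨hb, hd⟩, ?_⟩
  · rw [pow_add]
    exact Ideal.mul_mem_mul ha hc
  · simp only [ofPoly_mul, div_mul_div_comm]

theorem OrdAt.mul_regularAt {k : ℕ} {f g : V.FunctionField} (hf : V.OrdAt p k f)
    (hg : V.RegularAt g p) : V.OrdAt p k (f * g) := hf.mul hg.ordAt

theorem OrdAt.neg {k : ℕ} {f : V.FunctionField} (hf : V.OrdAt p k f) : V.OrdAt p k (-f) := by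
  have h1 : V.RegularAt (-1) p := by simpa using regularAt_algebraMap (V := V) (-1) p
  simpa using hf.mul_regularAt h1

theorem OrdAt.smul {k : ℕ} {f : V.FunctionField} (c : ℂ) (hf : V.OrdAt p k f) :
    V.OrdAt p k (c • f) := by
  rw [Algebra.smul_def, mul_comm]
  exact hf.mul_regularAt (regularAt_algebraMap c p)

theorem OrdAt.add (hp : p ∈ V.carrier) {k : ℕ} {f g : V.FunctionField} (hf : V.OrdAt p k f)
    (hg : V.OrdAt p k g) : V.OrdAt p k (f + g) := by
  obtain ⟨a, b, ha, hb, rfl⟩ := hf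
  obtain ⟨c, d, hc, hd, rfl⟩ := hg
  refine ⟨a * d + b * c, b * d, add_mem (Ideal.mul_mem_right _ _ ha) (Ideal.mul_mem_left _ _ hc),
    by simpa using ⟨hb, hd⟩, ?_⟩
  simp only [ofPoly_add, ofPoly_mul]
  exact div_add_div _ _ (ofPoly_ne_zero hp hb) (ofPoly_ne_zero hp hd)

theorem OrdAt.sub (hp : p ∈ V.carrier) {k : ℕ} {f g : V.FunctionField} (hf : V.OrdAt p k f)
    (hg : V.OrdAt p k g) : V.OrdAt p k (f - g) := by
  rw [sub_eq_add_neg]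
  exact hf.add hp hg.neg

theorem OrdAt.sum (hp : p ∈ V.carrier) {ι : Type*} {k : ℕ} {s : Finset ι}
    {f : ι → V.FunctionField} (hf : ∀ i ∈ s, V.OrdAt p k (f i)) : V.OrdAt p k (∑ i ∈ s, f i) := by
  classical
  induction s using Finset.induction_on with
  | empty => simpa using ordAt_zero k
  | insert i s hi ih =>
    rw [Finset.sum_insert hi]
    exact (hf i (Finset.mem_insert_self i s)).add hp
      (ih fun j hj => hf j (Finset.mem_insert_of_mem hj))

theorem RegularAt.inv_ofPoly {b : MvPolynomial (Fin N) ℂ} (hb : MvPolynomial.eval p b ≠ 0) :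
    V.RegularAt (V.ofPoly b)⁻¹ p := ⟨(1, b), hb, by simp⟩

/-- `value` evaluates a chosen fraction. Cross-multiplying it with the given one yields a polynomial
in the vanishing ideal, which is zero at `q`. -/
theorem value_div {q : Fin N → ℂ} (hq : q ∈ V.carrier) {a b : MvPolynomial (Fin N) ℂ}
    (hb : MvPolynomial.eval q b ≠ 0) :
    V.value (V.ofPoly a / V.ofPoly b) q = MvPolynomial.eval q a / MvPolynomial.eval q b := by
  have h : V.RegularAt (V.ofPoly a / V.ofPoly b) q := ⟨(a, b), hb, rfl⟩
  rw [value, dif_pos h]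
  obtain ⟨hd, heq⟩ := h.choose_spec
  set c := h.choose.1
  set d := h.choose.2
  rw [div_eq_div_iff (ofPoly_ne_zero hq hb) (ofPoly_ne_zero hq hd), ← ofPoly_mul, ← ofPoly_mul,
    ← sub_eq_zero, ← ofPoly_sub, ofPoly_eq_zero_iff] at heq
  have h0 := MvPolynomial.mem_vanishingIdeal_iff.mp heq q hq
  rw [div_eq_div_iff hd hb]
  simp only [MvPolynomial.aeval_eq_eval, map_sub, map_mul] at h0
  linear_combination -h0

theorem value_ofPoly {q : Fin N → ℂ} (hq : q ∈ V.carrier) (a : MvPolynomial (Fin N) ℂ) :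
    V.value (V.ofPoly a) q = MvPolynomial.eval q a := by
  simpa using value_div (V := V) hq (a := a) (b := 1) (by simp)

theorem value_add {q : Fin N → ℂ} (hq : q ∈ V.carrier) {f g : V.FunctionField}
    (hf : V.RegularAt f q) (hg : V.RegularAt g q) :
    V.value (f + g) q = V.value f q + V.value g q := by
  obtain ⟨⟨a, b⟩, hb, rfl⟩ := hf
  obtain ⟨⟨c, d⟩, hd, rfl⟩ := hg
  simp only at hb hd ⊢
  rw [div_add_div _ _ (ofPoly_ne_zero hq hb) (ofPoly_ne_zero hq hd), ← ofPoly_mul, ← ofPoly_mul,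
    ← ofPoly_mul, ← ofPoly_add, value_div hq (by simpa using ⟨hb, hd⟩), value_div hq hb,
    value_div hq hd, div_add_div _ _ hb hd]
  simp

theorem value_mul {q : Fin N → ℂ} (hq : q ∈ V.carrier) {f g : V.FunctionField}
    (hf : V.RegularAt f q) (hg : V.RegularAt g q) :
    V.value (f * g) q = V.value f q * V.value g q := by
  obtain ⟨⟨a, b⟩, hb, rfl⟩ := hf
  obtain ⟨⟨c, d⟩, hd, rfl⟩ := hg
  simp only at hb hd ⊢
  rw [div_mul_div_comm, ← ofPoly_mul, ← ofPoly_mul, value_div hq (by simpa using ⟨hb, hd⟩),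
    value_div hq hb, value_div hq hd, div_mul_div_comm]
  simp

theorem value_algebraMap {q : Fin N → ℂ} (hq : q ∈ V.carrier) (c : ℂ) :
    V.value (algebraMap ℂ V.FunctionField c) q = c := by
  rw [← ofPoly_C, value_ofPoly hq, MvPolynomial.eval_C]

theorem RegularAt.ordAt_one (hp : p ∈ V.carrier) {f : V.FunctionField} (hf : V.RegularAt f p)
    (h0 : V.value f p = 0) : V.OrdAt p 1 f := by
  obtain ⟨⟨a, b⟩, hb, rfl⟩ := hf
  refine ⟨a, b, ?_, hb, rfl⟩
  simp only at hb h0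
  rw [value_div hp hb, div_eq_zero_iff] at h0
  rw [pow_one]
  exact mem_pointIdeal.mpr (h0.resolve_right hb)

theorem pointIdeal_ge (hp : p ∈ V.carrier) : V.ideal ≤ pointIdeal p := fun a ha => by
  simpa [mem_pointIdeal] using MvPolynomial.mem_vanishingIdeal_iff.mp ha p hp

/-! ### Brackets and orders of vanishing -/

namespace PoissonStructure

variable (π : V.PoissonStructure)

theorem bracket_div (f a : V.FunctionField) {b : V.FunctionField} (hb : b ≠ 0) :
    π.bracket f (a / b) = π.bracket f a * b⁻¹ - a * π.bracket f b * (b⁻¹ * b⁻¹) := by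
  have h := π.leibniz f (a / b) b
  rw [div_mul_cancel₀ a hb] at h
  rw [h]
  field_simp
  ring

theorem bracket_algebraMap (f : V.FunctionField) (c : ℂ) :
    π.bracket f (algebraMap ℂ V.FunctionField c) = 0 := by
  rw [Algebra.algebraMap_eq_smul_one, map_smul, π.bracket_one, smul_zero]

variable {π}

/-- Closure of conditions on brackets under passing from polynomials to regular functions. -/
theorem ordAt_bracket_div (hp : p ∈ V.carrier) {k : ℕ} {f a : V.FunctionField}
    {b : MvPolynomial (Fin N) ℂ} (hb : MvPolynomial.eval p b ≠ 0)
    (ha : V.OrdAt p k (π.bracket f a)) (hab : V.OrdAt p k (a * π.bracket f (V.ofPoly b))) :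
    V.OrdAt p k (π.bracket f (a / V.ofPoly b)) := by
  rw [π.bracket_div f a (ofPoly_ne_zero hp hb)]
  exact (ha.mul_regularAt (.inv_ofPoly hb)).sub hp
    (hab.mul_regularAt ((RegularAt.inv_ofPoly hb).mul (.inv_ofPoly hb)))

/-- The Poisson structure only promises regularity for globally regular functions. Polynomials are
such, and the quotient rule, applied to one argument after the other, passes to the local ring at
`p`. -/
theorem regularAt_bracket (hp : p ∈ V.carrier) {f g : V.FunctionField} (hf : V.RegularAt f p)
    (hg : V.RegularAt g p) : V.RegularAt (π.bracket f g) p := by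
  have h0 : ∀ a b, V.OrdAt p 0 (π.bracket (V.ofPoly a) (V.ofPoly b)) := fun a b =>
    (π.regular _ _ (fun q _ => regularAt_ofPoly a q) (fun q _ => regularAt_ofPoly b q) p hp).ordAt
  have h1 : ∀ a, V.OrdAt p 0 (π.bracket (V.ofPoly a) g) := fun a => by
    obtain ⟨⟨c, d⟩, hd, rfl⟩ := hg
    exact ordAt_bracket_div hp hd (h0 a c)
      ((regularAt_ofPoly c p).ordAt.mul_regularAt (h0 a d).regularAt)
  have h2 : V.OrdAt p 0 (π.bracket g f) := by
    obtain ⟨⟨a, b⟩, hb, rfl⟩ := hf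
    refine ordAt_bracket_div hp hb ?_ ?_
    · rw [π.bracket_swap]
      exact (h1 a).neg
    · rw [π.bracket_swap]
      exact (regularAt_ofPoly a p).ordAt.mul_regularAt (h1 b).neg.regularAt
  rw [π.bracket_swap g f]
  exact h2.neg.regularAt

theorem VanishesAt.ordAt_one (h0 : π.VanishesAt p) (hp : p ∈ V.carrier) {f g : V.FunctionField}
    (hf : V.RegularAt f p) (hg : V.RegularAt g p) : V.OrdAt p 1 (π.bracket f g) :=
  (regularAt_bracket hp hf hg).ordAt_one hp (h0 f g hf hg)

/-- As `π` vanishes at `p`, the derivation `{f, ·}` maps the maximal ideal to itself, and by the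
Leibniz rule also each of its powers. -/
theorem VanishesAt.ordAt_right (h0 : π.VanishesAt p) (hp : p ∈ V.carrier) {k : ℕ}
    {f g : V.FunctionField} (hf : V.RegularAt f p) (hg : V.OrdAt p k g) :
    V.OrdAt p k (π.bracket f g) := by
  obtain ⟨a, b, ha, hb, rfl⟩ := hg
  refine ordAt_bracket_div hp hb ?_ ?_
  · clear hb
    induction k generalizing a with
    | zero => exact (regularAt_bracket hp hf (regularAt_ofPoly a p)).ordAt
    | succ k ih =>
      rw [pow_succ'] at ha
      refine Submodule.mul_induction_on ha (fun x hx y hy => ?_) fun x y hx hy => ?_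
      · rw [ofPoly_mul, π.leibniz, add_comm k 1]
        refine ((h0.ordAt_one hp hf (regularAt_ofPoly x p)).mul
          (ordAt_ofPoly (Ideal.mem_sup_left hy))).add hp ?_
        refine (ordAt_ofPoly (k := 1) (Ideal.mem_sup_left ?_)).mul (ih y hy)
        rwa [pow_one]
      · rw [ofPoly_add, map_add]
        exact hx.add hp hy
  · exact (ordAt_ofPoly (Ideal.mem_sup_left ha)).mul_regularAt
      (regularAt_bracket hp hf (regularAt_ofPoly b p))

theorem VanishesAt.ordAt_left (h0 : π.VanishesAt p) (hp : p ∈ V.carrier) {k : ℕ}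
    {f g : V.FunctionField} (hf : V.OrdAt p k f) (hg : V.RegularAt g p) :
    V.OrdAt p k (π.bracket f g) := by
  rw [π.bracket_swap g f]
  exact (h0.ordAt_right hp hg hf).neg

/-- The bracket loses only one order: two derivatives cost two, the vanishing of `π` returns one. In
the induction, `{f, x y} = {f, x} y + x {f, y}` with `x` in the maximal ideal. -/
theorem VanishesAt.ordAt_bracket (h0 : π.VanishesAt p) (hp : p ∈ V.carrier) {j k : ℕ}
    {f g : V.FunctionField} (hf : V.OrdAt p j f) (hg : V.OrdAt p k g) :
    V.OrdAt p (j + k - 1) (π.bracket f g) := by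
  obtain ⟨a, b, ha, hb, rfl⟩ := hg
  refine ordAt_bracket_div hp hb ?_ ?_
  · clear hb
    induction k generalizing a with
    | zero => exact (h0.ordAt_left hp hf (regularAt_ofPoly a p)).mono (by omega)
    | succ k ih =>
      rw [pow_succ'] at ha
      refine Submodule.mul_induction_on ha (fun x hx y hy => ?_) fun x y hx hy => ?_
      · rw [ofPoly_mul, π.leibniz]
        refine (((h0.ordAt_left hp hf (regularAt_ofPoly x p)).mul
          (ordAt_ofPoly (Ideal.mem_sup_left hy))).mono (by omega)).add hp ?_
        have hx1 : V.OrdAt p 1 (V.ofPoly x) := ordAt_ofPoly (Ideal.mem_sup_left (by rwa [pow_one]))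
        exact (hx1.mul (ih y hy)).mono (by omega)
      · rw [ofPoly_add, map_add]
        exact hx.add hp hy
  · exact ((ordAt_ofPoly (Ideal.mem_sup_left ha)).mul
      (h0.ordAt_left hp hf (regularAt_ofPoly b p))).mono (by omega)

end PoissonStructure

/-! ### Local parameters -/

variable (V) in
/-- The polynomials `t i` restrict to local parameters of `P` at `p`, with the differentials of
the coordinates given by `γ`. -/
structure IsParameterSystem {n : ℕ} (p : Fin N → ℂ) (γ : (Fin n → ℂ) → (Fin N → ℂ))
    (t : Fin n → MvPolynomial (Fin N) ℂ) : Prop where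
  mem : ∀ i, t i ∈ pointIdeal p
  diff : ∀ i v, diffAt p (t i) (fderiv ℂ γ 0 v) = v i
  span : ∀ a ∈ pointIdeal p, ∃ c : Fin n → ℂ,
    a - ∑ i, MvPolynomial.C (c i) * t i ∈ pointIdeal p ^ 2 ⊔ V.ideal

theorem IsCoordinateSystem.eventually_mem {n : ℕ} {γ : (Fin n → ℂ) → (Fin N → ℂ)}
    (hγ : V.IsCoordinateSystem p γ) : ∀ᶠ z in 𝓝 0, γ z ∈ V.carrier := by
  have h : Filter.Tendsto γ (𝓝 0) (𝓝[V.carrier] p) := hγ.map_nhds.le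
  exact h self_mem_nhdsWithin

theorem IsCoordinateSystem.mem {n : ℕ} {γ : (Fin n → ℂ) → (Fin N → ℂ)}
    (hγ : V.IsCoordinateSystem p γ) : p ∈ V.carrier := by
  simpa [hγ.base] using hγ.eventually_mem.self_of_nhds

theorem mem_zariskiTangent {v : Fin N → ℂ} :
    v ∈ V.zariskiTangent p ↔ ∀ a ∈ V.ideal, diffAt p a v = 0 := by
  simp only [zariskiTangent, Submodule.mem_iInf, LinearMap.mem_ker]
  rfl

theorem IsCoordinateSystem.hasFDerivAt_eval {n : ℕ} {γ : (Fin n → ℂ) → (Fin N → ℂ)}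
    (hγ : V.IsCoordinateSystem p γ) (a : MvPolynomial (Fin N) ℂ) :
    HasFDerivAt (fun z => MvPolynomial.eval (γ z) a)
      ((diffAt p a).toContinuousLinearMap ∘L fderiv ℂ γ 0) 0 := by
  have h := ClusterPoisson.hasFDerivAt_eval a (γ 0)
  rw [hγ.base] at h
  rw [← hγ.base] at h
  have h2 := h.comp 0 hγ.analytic.differentiableAt.hasFDerivAt
  rwa [hγ.base] at h2

/-- Polynomials in the ideal vanish along `γ`, so their differentials kill the image; smoothness and
the immersion property make the dimensions agree. -/
theorem IsCoordinateSystem.range_fderiv {n : ℕ} {γ : (Fin n → ℂ) → (Fin N → ℂ)}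
    (hγ : V.IsCoordinateSystem p γ) (hsm : V.IsSmoothPoint n p) :
    LinearMap.range (fderiv ℂ γ 0 : (Fin n → ℂ) →ₗ[ℂ] (Fin N → ℂ)) = V.zariskiTangent p := by
  refine Submodule.eq_of_le_of_finrank_eq ?_ ?_
  · rintro _ ⟨v, rfl⟩
    rw [mem_zariskiTangent]
    intro a ha
    have h0 : (fun z => MvPolynomial.eval (γ z) a) =ᶠ[𝓝 0] fun _ => 0 := by
      filter_upwards [hγ.eventually_mem] with z hz
      simpa using MvPolynomial.mem_vanishingIdeal_iff.mp ha _ hz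
    have h1 := (hγ.hasFDerivAt_eval a).congr_of_eventuallyEq h0.symm
    have h2 := h1.unique (hasFDerivAt_const (0 : ℂ) (0 : Fin n → ℂ))
    simpa using DFunLike.congr_fun h2 v
  · rw [hsm.2, LinearMap.finrank_range_of_inj hγ.immersion]
    simp

/-- The parameters are the components of a linear left inverse `ρ` of the differential of `γ`,
applied to `x - p`. They span the cotangent space because a differential that kills the tangent
space comes from the ideal of the variety. -/
theorem IsCoordinateSystem.exists_parameterSystem {n : ℕ} {γ : (Fin n → ℂ) → (Fin N → ℂ)}
    (hγ : V.IsCoordinateSystem p γ) (hsm : V.IsSmoothPoint n p) :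
    ∃ t, V.IsParameterSystem p γ t := by
  set Λ : (Fin n → ℂ) →ₗ[ℂ] (Fin N → ℂ) := (fderiv ℂ γ 0 : (Fin n → ℂ) →ₗ[ℂ] (Fin N → ℂ)) with hΛ
  obtain ⟨ρ, hρ⟩ := Λ.exists_leftInverse_of_injective (LinearMap.ker_eq_bot.mpr hγ.immersion)
  set t : Fin n → MvPolynomial (Fin N) ℂ := fun i =>
    ∑ k, MvPolynomial.C (ρ (Pi.single k 1) i) * (MvPolynomial.X k - MvPolynomial.C (p k)) with ht
  have hdt : ∀ i v, diffAt p (t i) v = ρ v i := fun i v => by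
    have h1 : ∀ j, MvPolynomial.eval p (MvPolynomial.pderiv j (t i)) = ρ (Pi.single j 1) i :=
      fun j => by
        simp only [ht, map_sum, Derivation.leibniz, map_sub, MvPolynomial.pderiv_C,
          MvPolynomial.pderiv_X, smul_eq_mul, mul_zero, add_zero, sub_zero, map_mul,
          MvPolynomial.eval_C]
        rw [Finset.sum_eq_single j]
        · simp
        · intro b _ hb
          simp [Pi.single_eq_of_ne hb]
        · simp
    rw [diffAt_apply]
    simp only [h1]
    conv_rhs => rw [← Finset.univ_sum_single v]
    rw [map_sum, Finset.sum_apply]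
    refine Finset.sum_congr rfl fun j _ => ?_
    have : (Pi.single j (v j) : Fin N → ℂ) = v j • Pi.single j 1 := by
      rw [← Pi.single_smul, smul_eq_mul, mul_one]
    rw [this, map_smul, Pi.smul_apply, smul_eq_mul, mul_comm]
  have hmem : ∀ i, t i ∈ pointIdeal p := fun i =>
    sum_mem fun k _ => Ideal.mul_mem_left _ _ (X_sub_C_mem_pointIdeal k)
  refine ⟨t, hmem, fun i v => ?_, fun a ha => ?_⟩
  · rw [hdt]
    exact congrFun (LinearMap.congr_fun hρ v) i
  · set c : Fin n → ℂ := fun i => diffAt p a (Λ (Pi.single i 1)) with hc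
    set b := a - ∑ i, MvPolynomial.C (c i) * t i with hb
    -- The conormal space: its common kernel is the Zariski tangent space, so in finite dimension it
    -- is exactly the annihilator of that space.
    set W : Submodule ℂ (Module.Dual ℂ (Fin N → ℂ)) :=
      (V.ideal.restrictScalars ℂ).map (diffAt p) with hW
    have hWT : W.dualCoannihilator = V.zariskiTangent p := by
      ext v
      rw [Submodule.mem_dualCoannihilator, mem_zariskiTangent]
      constructor
      · exact fun h a ha => h _ ⟨a, ha, rfl⟩
      · rintro h _ ⟨a, ha, rfl⟩
        exact h a ha
    have hdb : diffAt p b ∈ W := by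
      rw [← Subspace.dualCoannihilator_dualAnnihilator_eq (W := W), hWT, ← hγ.range_fderiv hsm,
        Submodule.mem_dualAnnihilator]
      rintro _ ⟨v, rfl⟩
      have h1 : ∀ i, diffAt p (MvPolynomial.C (c i) * t i) = c i • diffAt p (t i) := fun i => by
        rw [← MvPolynomial.smul_eq_C_mul, map_smul]
      change diffAt p b (Λ v) = 0
      have h2 : ∀ i, ρ (Λ v) i = v i := fun i => congrFun (LinearMap.congr_fun hρ v) i
      simp only [hb, map_sub, map_sum, h1, LinearMap.sub_apply, LinearMap.sum_apply,
        LinearMap.smul_apply, hdt, smul_eq_mul, h2]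
      conv_lhs => enter [1]; rw [← Finset.univ_sum_single v]
      rw [map_sum, map_sum, ← Finset.sum_sub_distrib]
      refine Finset.sum_eq_zero fun j _ => ?_
      have : (Pi.single j (v j) : Fin n → ℂ) = v j • Pi.single j 1 := by
        rw [← Pi.single_smul, smul_eq_mul, mul_one]
      rw [this, map_smul, map_smul, smul_eq_mul, mul_comm, sub_self]
    obtain ⟨a', ha', hda'⟩ := hdb
    refine ⟨c, ?_⟩
    rw [← hb, ← sub_add_cancel b a']
    -- After subtracting the ideal element `a'` with the same differential as `b`, both value and
    -- differential at `p` are zero.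
    refine add_mem (Ideal.mem_sup_left (mem_pointIdeal_sq ?_ ?_)) (Ideal.mem_sup_right ha')
    · rw [← mem_pointIdeal]
      exact sub_mem (sub_mem ha (sum_mem fun i _ => Ideal.mul_mem_left _ _ (hmem i)))
        (pointIdeal_ge hγ.mem ha')
    · rw [map_sub, hda', sub_self]

variable {n : ℕ} {γ : (Fin n → ℂ) → (Fin N → ℂ)} {t : Fin n → MvPolynomial (Fin N) ℂ}

/-- Nonzero regular functions at a smooth point have a leading form in the local parameters. -/
theorem IsParameterSystem.exists_leadingForm (ht : V.IsParameterSystem p γ t) (hp : p ∈ V.carrier)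
    {f : V.FunctionField} (hf : V.RegularAt f p) (hf0 : f ≠ 0) :
    ∃ (k : ℕ) (F : MvPolynomial (Fin n) ℂ), F ≠ 0 ∧ F.IsHomogeneous k ∧
      V.OrdAt p (k + 1) (f - V.ofPoly (MvPolynomial.bind₁ t F)) := by
  obtain ⟨⟨a, b⟩, hb, rfl⟩ := hf
  simp only at hb hf0
  have ha : a ∉ V.ideal := fun h => hf0 (by rw [ofPoly_eq_zero_iff.mpr h, zero_div])
  obtain ⟨k, hk, hk'⟩ := exists_mem_pow_sup_not_mem (pointIdeal_ge hp) ha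
  obtain ⟨u, hu, w, hw, rfl⟩ := Submodule.mem_sup.mp hk
  obtain ⟨F, hF, huF⟩ := ClusterPoisson.exists_leadingForm ht.mem ht.span k hu
  -- To leading order, dividing by `b` is dividing by the constant `b(p)`.
  refine ⟨k, MvPolynomial.C (MvPolynomial.eval p b)⁻¹ * F, ?_, ?_, ?_⟩
  · rintro h0
    have hF0 : F = 0 := (mul_eq_zero.mp h0).resolve_left (by simpa using hb)
    rw [hF0, map_zero, sub_zero] at huF
    exact hk' (add_mem huF (Ideal.mem_sup_right hw))
  · simpa using (MvPolynomial.isHomogeneous_C _ _).mul hF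
  · have heq : V.ofPoly (u + w) / V.ofPoly b - V.ofPoly (MvPolynomial.bind₁ t
        (MvPolynomial.C (MvPolynomial.eval p b)⁻¹ * F)) =
        V.ofPoly ((u - MvPolynomial.bind₁ t F) +
          (1 - MvPolynomial.C (MvPolynomial.eval p b)⁻¹ * b) * MvPolynomial.bind₁ t F) /
            V.ofPoly b := by
      have := ofPoly_ne_zero hp hb
      rw [ofPoly_add, ofPoly_eq_zero_iff.mpr hw, map_mul]
      simp only [ofPoly_add, ofPoly_sub, ofPoly_mul, ofPoly_one, MvPolynomial.bind₁_C_right]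
      field_simp
      ring
    rw [heq]
    refine ordAt_div (add_mem huF (Ideal.mem_sup_left ?_)) hb
    rw [pow_succ']
    refine Ideal.mul_mem_mul ?_ (bind₁_mem_pow ht.mem hF)
    simp [mem_pointIdeal, hb]

theorem IsParameterSystem.exists_linearPart (ht : V.IsParameterSystem p γ t) (hp : p ∈ V.carrier)
    {f : V.FunctionField} (hf : V.RegularAt f p) :
    ∃ (c₀ : ℂ) (c : Fin n → ℂ),
      V.OrdAt p 2 (f - algebraMap ℂ _ c₀ - ∑ i, c i • V.ofPoly (t i)) := by
  obtain ⟨⟨a, b⟩, hb, rfl⟩ := hf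
  simp only at hb
  set c₀ := MvPolynomial.eval p a / MvPolynomial.eval p b with hc₀
  -- `c₀` is the value of the function at `p`, so this numerator of the function minus `c₀` lies in
  -- the maximal ideal.
  obtain ⟨c, hc⟩ := ht.span (a - MvPolynomial.C c₀ * b) (by
    rw [mem_pointIdeal]
    simp only [map_sub, map_mul, MvPolynomial.eval_C, hc₀]
    rw [div_mul_cancel₀ _ hb, sub_self])
  set β := MvPolynomial.eval p b
  refine ⟨c₀, fun i => c i / β, ?_⟩
  have hb' := ofPoly_ne_zero hp hb
  have hsum : V.ofPoly (∑ i, MvPolynomial.C (c i) * t i) =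
      ∑ i, algebraMap ℂ V.FunctionField (c i) * V.ofPoly (t i) := by
    rw [show ∀ x, V.ofPoly x = ((algebraMap V.CoordRing V.FunctionField).comp
      (Ideal.Quotient.mk V.ideal)) x from fun _ => rfl, map_sum]
    refine Finset.sum_congr rfl fun i _ => ?_
    rw [map_mul]
    congr 1
  have heq : V.ofPoly a / V.ofPoly b - algebraMap ℂ _ c₀ - ∑ i, (c i / β) • V.ofPoly (t i) =
      V.ofPoly ((a - MvPolynomial.C c₀ * b - ∑ i, MvPolynomial.C (c i) * t i) +
        (1 - MvPolynomial.C β⁻¹ * b) * ∑ i, MvPolynomial.C (c i) * t i) / V.ofPoly b := by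
    have h1 : ∑ i, (c i / β) • V.ofPoly (t i) =
        V.ofPoly (MvPolynomial.C β⁻¹) * V.ofPoly (∑ i, MvPolynomial.C (c i) * t i) := by
      rw [hsum, Finset.mul_sum]
      refine Finset.sum_congr rfl fun i _ => ?_
      rw [Algebra.smul_def, ofPoly_C, div_eq_inv_mul, map_mul, mul_assoc]
    rw [h1]
    simp only [ofPoly_add, ofPoly_sub, ofPoly_mul, ofPoly_one, ← ofPoly_C]
    field_simp
    ring
  rw [heq]
  refine ordAt_div (add_mem hc (Ideal.mem_sup_left ?_)) hb
  rw [pow_two]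
  refine Ideal.mul_mem_mul ?_ (sum_mem fun i _ => Ideal.mul_mem_left _ _ (ht.mem i))
  simp [mem_pointIdeal, β, hb]

end QuasiAffineVariety

end ClusterPoisson

namespace ClusterPoisson

/-! ### Orders of vanishing of holomorphic functions -/

section Analytic

open Asymptotics

variable {N n : ℕ}

theorem isBigO_eval_of_mem_pow {γ : (Fin n → ℂ) → (Fin N → ℂ)} (hγ : DifferentiableAt ℂ γ 0)
    (k : ℕ) {a : MvPolynomial (Fin N) ℂ} (ha : a ∈ pointIdeal (γ 0) ^ k) :
    (fun z => MvPolynomial.eval (γ z) a) =O[𝓝 0] fun z => ‖z‖ ^ k := by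
  have hdiff : ∀ b : MvPolynomial (Fin N) ℂ,
      DifferentiableAt ℂ (fun z => MvPolynomial.eval (γ z) b) 0 := fun b =>
    ((hasFDerivAt_eval b (γ 0)).differentiableAt).comp 0 hγ
  induction k generalizing a with
  | zero => simpa using (hdiff a).continuousAt.isBigO_one ℝ
  | succ k ih =>
    rw [pow_succ'] at ha
    refine Submodule.mul_induction_on ha (fun x hx y hy => ?_) fun x y hx hy => ?_
    · have h1 : (fun z => MvPolynomial.eval (γ z) x) =O[𝓝 0] fun z => ‖z‖ := by
        have := (hdiff x).isBigO_sub
        rw [mem_pointIdeal] at hx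
        simpa [hx] using this.norm_right
      simpa [pow_succ'] using h1.mul (ih hy)
    · simpa using hx.add hy

theorem isBigO_sq_of_analyticAt {h : (Fin n → ℂ) → ℂ} (hh : AnalyticAt ℂ h 0) (h0 : h 0 = 0)
    (h1 : HasFDerivAt h (0 : (Fin n → ℂ) →L[ℂ] ℂ) 0) : h =O[𝓝 0] fun z => ‖z‖ ^ 2 := by
  obtain ⟨P, hP⟩ := hh
  have h2 := hP.isBigO_sub_partialSum_pow 2
  have h3 := hP.hasFDerivAt.unique h1
  refine h2.congr_left fun y => ?_
  have hy : P 1 (fun _ => y) = 0 := by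
    have := DFunLike.congr_fun h3 y
    rw [continuousMultilinearCurryFin1_apply] at this
    convert! this using 2
  simp only [FormalMultilinearSeries.partialSum, Finset.sum_range_succ, Finset.range_zero,
    Finset.sum_empty, zero_add, hy, add_zero]
  rw [hP.coeff_zero, h0, sub_zero]

theorem IsHomogeneous.mem_pointIdeal_zero_pow {k : ℕ} {F : MvPolynomial (Fin n) ℂ}
    (hF : F.IsHomogeneous k) : F ∈ pointIdeal (0 : Fin n → ℂ) ^ k := by
  have h := bind₁_mem_pow (p := (0 : Fin n → ℂ)) (t := fun i => MvPolynomial.X i)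
    (fun i => by simp [mem_pointIdeal]) hF
  have h1 : MvPolynomial.bind₁ (fun i => MvPolynomial.X i) F = F := MvPolynomial.aeval_X_left_apply F
  rwa [h1] at h

/-- A change of variables tangent to the identity preserves leading terms. For a product, the
difference is `(x∘w - x) (y∘w) + x (y∘w - y)`, where each difference gains one order. -/
theorem isBigO_eval_sub_eval {w : (Fin n → ℂ) → (Fin n → ℂ)} (hw : AnalyticAt ℂ w 0)
    (hw0 : w 0 = 0) (hw1 : HasFDerivAt w (ContinuousLinearMap.id ℂ (Fin n → ℂ)) 0)
    (k : ℕ) {F : MvPolynomial (Fin n) ℂ} (hF : F ∈ pointIdeal (0 : Fin n → ℂ) ^ k) :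
    (fun z => MvPolynomial.eval (w z) F - MvPolynomial.eval z F) =O[𝓝 0]
      fun z => ‖z‖ ^ (k + 1) := by
  have hder : ∀ x : MvPolynomial (Fin n) ℂ, HasFDerivAt
      (fun z => MvPolynomial.eval (w z) x - MvPolynomial.eval z x)
      (0 : (Fin n → ℂ) →L[ℂ] ℂ) 0 := fun x => by
    have h1 := hasFDerivAt_eval x (w 0)
    have h2 := (h1.comp 0 hw1).sub (hasFDerivAt_eval x 0)
    refine h2.congr_fderiv ?_
    rw [hw0]
    ext v
    simp
  induction k generalizing F with
  | zero =>
    have := (hder F).isBigO_sub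
    simpa [hw0] using this.norm_right
  | succ k ih =>
    rw [pow_succ'] at hF
    refine Submodule.mul_induction_on hF (fun x hx y hy => ?_) fun x y hx hy => ?_
    · have hx2 : (fun z => MvPolynomial.eval (w z) x - MvPolynomial.eval z x) =O[𝓝 0]
          fun z => ‖z‖ ^ 2 := by
        refine isBigO_sq_of_analyticAt ?_ (by simp [hw0]) (hder x)
        refine AnalyticAt.sub ?_ (analyticAt_eval x 0)
        exact (analyticAt_eval x (w 0)).comp hw
      have hy1 := isBigO_eval_of_mem_pow hw.differentiableAt k (hw0.symm ▸ hy)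
      have hx1 := isBigO_eval_of_mem_pow (γ := fun z : Fin n → ℂ => z) differentiableAt_id 1
        (a := x) (by simpa using hx)
      have h1 := (hx2.mul hy1).congr_right (g₂ := fun z => ‖z‖ ^ (k + 1 + 1)) fun z => by ring
      have h2 := (hx1.mul (ih hy)).congr_right (g₂ := fun z => ‖z‖ ^ (k + 1 + 1)) fun z => by ring
      refine (h1.add h2).congr_left fun z => ?_
      simp only [map_mul]
      ring
    · refine (hx.add hy).congr_left fun z => ?_
      simp only [map_add]
      ring

theorem eval_smul_of_isHomogeneous {k : ℕ} {F : MvPolynomial (Fin n) ℂ} (hF : F.IsHomogeneous k)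
    (c : ℂ) (v : Fin n → ℂ) :
    MvPolynomial.eval (c • v) F = c ^ k * MvPolynomial.eval v F := by
  rw [MvPolynomial.eval_eq, MvPolynomial.eval_eq, Finset.mul_sum]
  refine Finset.sum_congr rfl fun d hd => ?_
  have hdeg : ∑ i ∈ d.support, d i = k := by
    have h : Finsupp.degree d = k := by
      rw [Finsupp.degree_eq_weight_one]
      exact hF (MvPolynomial.mem_support_iff.mp hd)
    exact h
  simp only [Pi.smul_apply, smul_eq_mul, mul_pow, Finset.prod_mul_distrib]
  rw [Finset.prod_pow_eq_pow_sum, hdeg]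
  ring

theorem tendsto_smul_line (v : Fin n → ℂ) :
    Filter.Tendsto (fun s : ℂ => s • v) (𝓝[≠] 0) (𝓝 0) := by
  have : Filter.Tendsto (fun s : ℂ => s • v) (𝓝 0) (𝓝 0) := by
    have h : Continuous fun s : ℂ => s • v := by fun_prop
    simpa using h.tendsto 0
  exact this.mono_left nhdsWithin_le_nhds

theorem IsBigO.comp_line {h : (Fin n → ℂ) → ℂ} {k : ℕ} (hh : h =O[𝓝 0] fun z => ‖z‖ ^ k)
    (v : Fin n → ℂ) : (fun s : ℂ => h (s • v)) =O[𝓝[≠] 0] fun s => s ^ k := by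
  have h1 := hh.comp_tendsto (tendsto_smul_line v)
  refine h1.trans ?_
  refine IsBigO.of_bound (‖v‖ ^ k) (Filter.Eventually.of_forall fun s => ?_)
  simp [norm_smul, mul_pow, mul_comm]

/-- A multiple of `s ^ j` by a nonzero constant has order at most `j`. -/
theorem eq_zero_of_isBigO_pow {c : ℂ} {j k : ℕ} (hjk : j < k)
    (h : (fun s : ℂ => c * s ^ j) =O[𝓝[≠] 0] fun s => s ^ k) : c = 0 := by
  have h1 : (fun s : ℂ => s ^ k) =o[𝓝[≠] 0] fun s => s ^ j :=
    (isLittleO_pow_pow hjk).mono nhdsWithin_le_nhds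
  by_contra hc
  have h2 : (fun s : ℂ => s ^ j) =o[𝓝[≠] 0] fun s : ℂ => s ^ j :=
    ((isBigO_const_mul_self c⁻¹ _ _).congr_left (f₂ := fun s : ℂ => s ^ j) (fun s => by
      rw [inv_mul_cancel_left₀ hc])).trans_isLittleO (h.trans_isLittleO h1)
  have h3 : ∀ᶠ s : ℂ in 𝓝[≠] 0, s ^ j = 0 := by
    simpa using isLittleO_irrefl' (f' := fun s : ℂ => s ^ j) (l := 𝓝[≠] (0 : ℂ)) |>.mt
      (not_not.mpr h2)
  obtain ⟨s, hs0, hs⟩ := (h3.and self_mem_nhdsWithin).exists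
  exact pow_ne_zero j hs hs0

/-- On each line through the origin `F` is `F(v) s ^ k`, which can only be of higher order if `F(v)
= 0`. -/
theorem eq_zero_of_isBigO {k : ℕ} {F : MvPolynomial (Fin n) ℂ} (hF : F.IsHomogeneous k)
    (h : (fun z => MvPolynomial.eval z F) =O[𝓝 0] fun z => ‖z‖ ^ (k + 1)) : F = 0 := by
  refine MvPolynomial.funext fun v => ?_
  rw [map_zero]
  refine eq_zero_of_isBigO_pow (Nat.lt_succ_self k) ((IsBigO.comp_line h v).congr_left fun s => ?_)
  rw [eval_smul_of_isHomogeneous hF, mul_comm]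

end Analytic

namespace QuasiAffineVariety

open Asymptotics

variable {N : ℕ} {V : QuasiAffineVariety N} {p : Fin N → ℂ} {n : ℕ}
  {γ : (Fin n → ℂ) → (Fin N → ℂ)} {t : Fin n → MvPolynomial (Fin N) ℂ}

/-! ### Rational functions in local coordinates -/

theorem IsCoordinateSystem.eventually_eval_ne_zero (hγ : V.IsCoordinateSystem p γ)
    {b : MvPolynomial (Fin N) ℂ} (hb : MvPolynomial.eval p b ≠ 0) :
    ∀ᶠ z in 𝓝 0, MvPolynomial.eval (γ z) b ≠ 0 := by
  have hc : ContinuousAt (fun z => MvPolynomial.eval (γ z) b) 0 :=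
    (hγ.hasFDerivAt_eval b).differentiableAt.continuousAt
  exact hc.eventually_ne (by rwa [hγ.base])

theorem IsCoordinateSystem.inCoord_div (hγ : V.IsCoordinateSystem p γ)
    (a : MvPolynomial (Fin N) ℂ) {b : MvPolynomial (Fin N) ℂ} (hb : MvPolynomial.eval p b ≠ 0) :
    V.inCoord γ (V.ofPoly a / V.ofPoly b) =ᶠ[𝓝 0]
      fun z => MvPolynomial.eval (γ z) a / MvPolynomial.eval (γ z) b := by
  filter_upwards [hγ.eventually_mem, hγ.eventually_eval_ne_zero hb] with z hz hbz
  exact value_div hz hbz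

theorem IsCoordinateSystem.inCoord_ofPoly (hγ : V.IsCoordinateSystem p γ)
    (a : MvPolynomial (Fin N) ℂ) :
    V.inCoord γ (V.ofPoly a) =ᶠ[𝓝 0] fun z => MvPolynomial.eval (γ z) a := by
  filter_upwards [hγ.eventually_mem] with z hz
  exact value_ofPoly hz a

theorem IsCoordinateSystem.eventually_regularAt (hγ : V.IsCoordinateSystem p γ)
    {f : V.FunctionField} (hf : V.RegularAt f p) : ∀ᶠ z in 𝓝 0, V.RegularAt f (γ z) := by
  obtain ⟨⟨a, b⟩, hb, rfl⟩ := hf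
  filter_upwards [hγ.eventually_eval_ne_zero hb] with z hz
  exact ⟨(a, b), hz, rfl⟩

theorem IsCoordinateSystem.inCoord_add (hγ : V.IsCoordinateSystem p γ) {f g : V.FunctionField}
    (hf : V.RegularAt f p) (hg : V.RegularAt g p) :
    V.inCoord γ (f + g) =ᶠ[𝓝 0] V.inCoord γ f + V.inCoord γ g := by
  filter_upwards [hγ.eventually_mem, hγ.eventually_regularAt hf, hγ.eventually_regularAt hg]
    with z hz hfz hgz
  exact value_add hz hfz hgz

theorem IsCoordinateSystem.inCoord_mul (hγ : V.IsCoordinateSystem p γ) {f g : V.FunctionField}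
    (hf : V.RegularAt f p) (hg : V.RegularAt g p) :
    V.inCoord γ (f * g) =ᶠ[𝓝 0] V.inCoord γ f * V.inCoord γ g := by
  filter_upwards [hγ.eventually_mem, hγ.eventually_regularAt hf, hγ.eventually_regularAt hg]
    with z hz hfz hgz
  exact value_mul hz hfz hgz

theorem IsCoordinateSystem.inCoord_algebraMap (hγ : V.IsCoordinateSystem p γ) (c : ℂ) :
    V.inCoord γ (algebraMap ℂ V.FunctionField c) =ᶠ[𝓝 0] fun _ => c := by
  filter_upwards [hγ.eventually_mem] with z hz
  exact value_algebraMap hz c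

theorem IsCoordinateSystem.analyticAt_inCoord (hγ : V.IsCoordinateSystem p γ)
    {f : V.FunctionField} (hf : V.RegularAt f p) : AnalyticAt ℂ (V.inCoord γ f) 0 := by
  obtain ⟨⟨a, b⟩, hb, rfl⟩ := hf
  refine AnalyticAt.congr ?_ (hγ.inCoord_div a hb).symm
  refine AnalyticAt.div ?_ ?_ (by rwa [hγ.base])
  · exact (analyticAt_eval a (γ 0)).comp hγ.analytic
  · exact (analyticAt_eval b (γ 0)).comp hγ.analytic

theorem IsCoordinateSystem.isBigO_inCoord (hγ : V.IsCoordinateSystem p γ) {k : ℕ}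
    {f : V.FunctionField} (hf : V.OrdAt p k f) :
    V.inCoord γ f =O[𝓝 0] fun z => ‖z‖ ^ k := by
  obtain ⟨a, b, ha, hb, rfl⟩ := hf
  have h1 := isBigO_eval_of_mem_pow hγ.analytic.differentiableAt k (hγ.base.symm ▸ ha)
  have h2 : (fun z => (MvPolynomial.eval (γ z) b)⁻¹) =O[𝓝 0] fun _ => (1 : ℝ) := by
    refine Filter.Tendsto.isBigO_one (c := (MvPolynomial.eval p b)⁻¹) ℝ ?_
    have hc := (hγ.hasFDerivAt_eval b).differentiableAt.continuousAt.inv₀ (by rwa [hγ.base])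
    rw [ContinuousAt, Pi.inv_apply, hγ.base] at hc
    exact hc
  refine IsBigO.congr' (h1.mul h2) ?_ (Filter.Eventually.of_forall fun z => by simp)
  filter_upwards [hγ.inCoord_div a hb] with z hz
  rw [hz, div_eq_mul_inv]

theorem IsCoordinateSystem.fderiv_inCoord_of_ordAt_two (hγ : V.IsCoordinateSystem p γ)
    {f : V.FunctionField} (hf : V.OrdAt p 2 f) : fderiv ℂ (V.inCoord γ f) 0 = 0 := by
  have h := hγ.isBigO_inCoord hf
  have h' : V.inCoord γ f =O[𝓝 0] fun z => ‖z - 0‖ ^ 2 := by simpa using h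
  exact (h'.hasFDerivAt one_lt_two).fderiv

theorem IsCoordinateSystem.fderiv_inCoord_add (hγ : V.IsCoordinateSystem p γ)
    {f g : V.FunctionField} (hf : V.RegularAt f p) (hg : V.RegularAt g p) :
    fderiv ℂ (V.inCoord γ (f + g)) 0 =
      fderiv ℂ (V.inCoord γ f) 0 + fderiv ℂ (V.inCoord γ g) 0 := by
  rw [(hγ.inCoord_add hf hg).fderiv_eq]
  exact fderiv_add (hγ.analyticAt_inCoord hf).differentiableAt
    (hγ.analyticAt_inCoord hg).differentiableAt

theorem IsCoordinateSystem.fderiv_inCoord_smul (hγ : V.IsCoordinateSystem p γ) (c : ℂ)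
    {f : V.FunctionField} (hf : V.RegularAt f p) :
    fderiv ℂ (V.inCoord γ (c • f)) 0 = c • fderiv ℂ (V.inCoord γ f) 0 := by
  have h : V.inCoord γ (c • f) =ᶠ[𝓝 0] c • V.inCoord γ f := by
    rw [Algebra.smul_def]
    filter_upwards [hγ.inCoord_mul (regularAt_algebraMap c p) hf, hγ.inCoord_algebraMap c]
      with z hz hcz
    rw [hz, Pi.mul_apply, hcz, Pi.smul_apply, smul_eq_mul]
  rw [h.fderiv_eq]
  exact fderiv_const_smul (hγ.analyticAt_inCoord hf).differentiableAt c

theorem IsCoordinateSystem.fderiv_inCoord_algebraMap (hγ : V.IsCoordinateSystem p γ) (c : ℂ) :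
    fderiv ℂ (V.inCoord γ (algebraMap ℂ V.FunctionField c)) 0 = 0 := by
  rw [(hγ.inCoord_algebraMap c).fderiv_eq]
  simp

theorem IsCoordinateSystem.fderiv_inCoord_sum (hγ : V.IsCoordinateSystem p γ) {ι : Type*}
    (s : Finset ι) {f : ι → V.FunctionField} (hf : ∀ i, V.RegularAt (f i) p) :
    V.RegularAt (∑ i ∈ s, f i) p ∧ fderiv ℂ (V.inCoord γ (∑ i ∈ s, f i)) 0 =
      ∑ i ∈ s, fderiv ℂ (V.inCoord γ (f i)) 0 := by
  classical
  induction s using Finset.induction_on with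
  | empty =>
    have := hγ.fderiv_inCoord_algebraMap 0
    rw [map_zero] at this
    exact ⟨by simpa using (ordAt_zero (V := V) (p := p) 0).regularAt, by simpa using this⟩
  | insert i s hi ih =>
    rw [Finset.sum_insert hi, Finset.sum_insert hi, hγ.fderiv_inCoord_add (hf i) ih.1, ih.2]
    exact ⟨(hf i).add hγ.mem ih.1, rfl⟩

theorem IsParameterSystem.fderiv_inCoord (ht : V.IsParameterSystem p γ t)
    (hγ : V.IsCoordinateSystem p γ) (i : Fin n) :
    fderiv ℂ (V.inCoord γ (V.ofPoly (t i))) 0 = ContinuousLinearMap.proj i := by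
  rw [(hγ.inCoord_ofPoly (t i)).fderiv_eq, (hγ.hasFDerivAt_eval (t i)).fderiv]
  ext v
  simpa using ht.diff i v

/-- The first order Taylor expansion of a regular function in local parameters. -/
theorem IsParameterSystem.ordAt_sub_linearPart (ht : V.IsParameterSystem p γ t)
    (hγ : V.IsCoordinateSystem p γ) {f : V.FunctionField} (hf : V.RegularAt f p) :
    ∃ c₀ : ℂ, V.OrdAt p 2 (f - algebraMap ℂ _ c₀ -
      ∑ i, fderiv ℂ (V.inCoord γ f) 0 (Pi.single i 1) • V.ofPoly (t i)) := by
  obtain ⟨c₀, c, h⟩ := ht.exists_linearPart hγ.mem hf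
  refine ⟨c₀, ?_⟩
  set r := f - algebraMap ℂ _ c₀ - ∑ i, c i • V.ofPoly (t i) with hr
  have hreg : ∀ i, V.RegularAt (c i • V.ofPoly (t i)) p := fun i =>
    ((regularAt_ofPoly (t i) p).ordAt.smul (c i)).regularAt
  have hs := hγ.fderiv_inCoord_sum Finset.univ hreg
  have hf' : f = r + (algebraMap ℂ _ c₀ + ∑ i, c i • V.ofPoly (t i)) := by
    rw [hr]
    ring
  have hd : fderiv ℂ (V.inCoord γ f) 0 = ∑ i, c i • ContinuousLinearMap.proj i := by
    conv_lhs => rw [hf']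
    rw [hγ.fderiv_inCoord_add h.regularAt ((regularAt_algebraMap c₀ p).add hγ.mem hs.1),
      hγ.fderiv_inCoord_of_ordAt_two h, hγ.fderiv_inCoord_add (regularAt_algebraMap c₀ p) hs.1,
      hγ.fderiv_inCoord_algebraMap, hs.2, zero_add, zero_add]
    refine Finset.sum_congr rfl fun i _ => ?_
    rw [hγ.fderiv_inCoord_smul _ (regularAt_ofPoly _ _), ht.fderiv_inCoord hγ]
  have hc : ∀ j, fderiv ℂ (V.inCoord γ f) 0 (Pi.single j 1) = c j := fun j => by
    rw [hd]
    simp [Pi.single_apply]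
  simp only [hc]
  exact h

/-- In the coordinates `z`, the parameters `t i` form a map `w` tangent to the identity, so
substituting them for `z` affects only higher order terms. -/
theorem IsParameterSystem.isBigO_bind₁_sub (ht : V.IsParameterSystem p γ t)
    (hγ : V.IsCoordinateSystem p γ) {k : ℕ} {F : MvPolynomial (Fin n) ℂ} (hF : F.IsHomogeneous k) :
    (fun z => MvPolynomial.eval (γ z) (MvPolynomial.bind₁ t F) - MvPolynomial.eval z F) =O[𝓝 0]
      fun z => ‖z‖ ^ (k + 1) := by
  set w : (Fin n → ℂ) → (Fin n → ℂ) := fun z i => MvPolynomial.eval (γ z) (t i) with hw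
  have hw0 : w 0 = 0 := by
    funext i
    rw [hw]
    simp only [hγ.base]
    exact mem_pointIdeal.mp (ht.mem i)
  have hwa : AnalyticAt ℂ w 0 := by
    rw [analyticAt_pi_iff]
    exact fun i => (analyticAt_eval (t i) (γ 0)).comp hγ.analytic
  have hw1 : HasFDerivAt w (ContinuousLinearMap.id ℂ (Fin n → ℂ)) 0 := by
    rw [hasFDerivAt_pi']
    intro i
    refine (hγ.hasFDerivAt_eval (t i)).congr_fderiv ?_
    ext v
    simpa using ht.diff i v
  refine (isBigO_eval_sub_eval hwa hw0 hw1 k (IsHomogeneous.mem_pointIdeal_zero_pow hF)).congr_left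
    fun z => ?_
  congr 1
  rw [← MvPolynomial.coe_aeval_eq_eval, ← MvPolynomial.coe_aeval_eq_eval, RingHom.coe_coe,
    RingHom.coe_coe, MvPolynomial.aeval_bind₁]
  rfl

/-- The bridge from the algebraic leading form in the local ring to the Taylor expansion in
holomorphic coordinates. -/
theorem IsParameterSystem.isLowestTerm (ht : V.IsParameterSystem p γ t)
    (hγ : V.IsCoordinateSystem p γ) {k : ℕ} {f : V.FunctionField} {F : MvPolynomial (Fin n) ℂ}
    (hF0 : F ≠ 0) (hF : F.IsHomogeneous k)
    (h : V.OrdAt p (k + 1) (f - V.ofPoly (MvPolynomial.bind₁ t F))) :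
    IsLowestTerm (V.inCoord γ f) F k := by
  refine ⟨hF0, hF, ?_⟩
  refine ((hγ.isBigO_inCoord h).add (ht.isBigO_bind₁_sub hγ hF)).congr' ?_ .rfl
  have h1 := hγ.inCoord_add h.regularAt (regularAt_ofPoly (MvPolynomial.bind₁ t F) p)
  rw [sub_add_cancel] at h1
  filter_upwards [h1, hγ.inCoord_ofPoly (MvPolynomial.bind₁ t F)] with z hz hz'
  rw [hz, Pi.add_apply, hz']
  ring

/-- There are no homogeneous relations between local parameters modulo higher order. The proof is
analytic: high algebraic order forces a small Taylor expansion. -/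
theorem IsParameterSystem.eq_zero_of_ordAt (ht : V.IsParameterSystem p γ t)
    (hγ : V.IsCoordinateSystem p γ) {k : ℕ} {F : MvPolynomial (Fin n) ℂ}
    (hF : F.IsHomogeneous k) (h : V.OrdAt p (k + 1) (V.ofPoly (MvPolynomial.bind₁ t F))) :
    F = 0 := by
  refine eq_zero_of_isBigO hF (((hγ.isBigO_inCoord h).sub
    (ht.isBigO_bind₁_sub hγ hF)).congr' ?_ .rfl)
  filter_upwards [hγ.inCoord_ofPoly (MvPolynomial.bind₁ t F)] with z hz
  rw [hz]
  ring

end QuasiAffineVariety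

end ClusterPoisson

namespace ClusterPoisson

/-! ### Linear forms and differentials of polynomials -/

theorem polyD_eq {n : ℕ} (F : MvPolynomial (Fin n) ℂ) (v : Fin n → ℂ) :
    polyD F v = (diffAt v F).toContinuousLinearMap := (hasFDerivAt_eval F v).fderiv

theorem polyD_eq_sum {n : ℕ} (F : MvPolynomial (Fin n) ℂ) (v : Fin n → ℂ) :
    polyD F v = ∑ a, MvPolynomial.eval v (MvPolynomial.pderiv a F) •
      (ContinuousLinearMap.proj a : Cotangent n) := by
  rw [polyD_eq]
  ext w
  simp [diffAt_apply]

theorem IsHomogeneous.pderiv_eq_zero {n : ℕ} {F : MvPolynomial (Fin n) ℂ} (hF : F.IsHomogeneous 0)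
    (a : Fin n) : MvPolynomial.pderiv a F = 0 := by
  rw [MvPolynomial.totalDegree_eq_zero_iff_eq_C.mp (Nat.le_zero.mp hF.totalDegree_le),
    MvPolynomial.pderiv_C]

/-- The linear form on `ℂⁿ` given by a cotangent vector, as a polynomial. -/
noncomputable def Cotangent.toPoly {n : ℕ} (ξ : Cotangent n) : MvPolynomial (Fin n) ℂ :=
  ∑ i, MvPolynomial.C (ξ (Pi.single i 1)) * MvPolynomial.X i

theorem Cotangent.isHomogeneous_toPoly {n : ℕ} (ξ : Cotangent n) :
    (Cotangent.toPoly ξ).IsHomogeneous 1 := MvPolynomial.IsHomogeneous.sum _ _ _ fun i _ => by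
  simpa using (MvPolynomial.isHomogeneous_C _ _).mul (MvPolynomial.isHomogeneous_X ℂ i)

theorem Cotangent.eq_sum {n : ℕ} (ξ : Cotangent n) :
    ξ = ∑ i, ξ (Pi.single i 1) • (ContinuousLinearMap.proj i : Cotangent n) := by
  ext v
  conv_lhs => rw [← Finset.univ_sum_single v]
  rw [map_sum]
  simp only [_root_.sum_apply, _root_.smul_apply, ContinuousLinearMap.proj_apply, smul_eq_mul]
  refine Finset.sum_congr rfl fun j _ => ?_
  have : (Pi.single j (v j) : Fin n → ℂ) = v j • Pi.single j 1 := by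
    rw [← Pi.single_smul, smul_eq_mul, mul_one]
  rw [this, map_smul, smul_eq_mul, mul_comm]

theorem Cotangent.eval_toPoly {n : ℕ} (ξ : Cotangent n) (v : Fin n → ℂ) :
    MvPolynomial.eval v (Cotangent.toPoly ξ) = ξ v := by
  conv_rhs => rw [Cotangent.eq_sum ξ]
  simp [Cotangent.toPoly]

namespace QuasiAffineVariety

variable {N : ℕ} {V : QuasiAffineVariety N} {p : Fin N → ℂ} {n : ℕ}
  {γ : (Fin n → ℂ) → (Fin N → ℂ)} {t : Fin n → MvPolynomial (Fin N) ℂ}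

theorem ofPoly_sum {ι : Type*} (s : Finset ι) (f : ι → MvPolynomial (Fin N) ℂ) :
    V.ofPoly (∑ i ∈ s, f i) = ∑ i ∈ s, V.ofPoly (f i) := by
  simp [ofPoly]

theorem ofPoly_bind₁_toPoly (ξ : Cotangent n) :
    V.ofPoly (MvPolynomial.bind₁ t (Cotangent.toPoly ξ)) =
      ∑ i, ξ (Pi.single i 1) • V.ofPoly (t i) := by
  simp only [Cotangent.toPoly, map_sum, map_mul, MvPolynomial.bind₁_C_right,
    MvPolynomial.bind₁_X_right, ofPoly_sum, ofPoly_mul, ofPoly_C, Algebra.smul_def]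

theorem IsCoordinateSystem.fderiv_inCoord_congr (hγ : V.IsCoordinateSystem p γ)
    {f g : V.FunctionField} (hg : V.RegularAt g p) (h : V.OrdAt p 2 (f - g)) :
    fderiv ℂ (V.inCoord γ f) 0 = fderiv ℂ (V.inCoord γ g) 0 := by
  have h1 := hγ.fderiv_inCoord_add h.regularAt hg
  rwa [sub_add_cancel, hγ.fderiv_inCoord_of_ordAt_two h, zero_add] at h1

theorem eq_zero_of_ordAt_one (hp : p ∈ V.carrier) {c : ℂ}
    (h : V.OrdAt p 1 (algebraMap ℂ V.FunctionField c)) : c = 0 := by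
  obtain ⟨a, b, ha, hb, hab⟩ := h
  rw [pow_one, mem_pointIdeal] at ha
  rw [← value_algebraMap (V := V) hp c, hab, value_div hp hb, ha, zero_div]

theorem IsParameterSystem.ordAt_sub_of_ordAt_one (ht : V.IsParameterSystem p γ t)
    (hγ : V.IsCoordinateSystem p γ) {f : V.FunctionField} (hf : V.OrdAt p 1 f) :
    V.OrdAt p 2 (f - V.ofPoly (MvPolynomial.bind₁ t
      (Cotangent.toPoly (fderiv ℂ (V.inCoord γ f) 0)))) := by
  obtain ⟨c, hc⟩ := ht.ordAt_sub_linearPart hγ hf.regularAt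
  rw [← ofPoly_bind₁_toPoly] at hc
  set l := MvPolynomial.bind₁ t (Cotangent.toPoly (fderiv ℂ (V.inCoord γ f) 0)) with hl
  have hl1 : V.OrdAt p 1 (V.ofPoly l) := ordAt_ofPoly (Ideal.mem_sup_left
    (bind₁_mem_pow ht.mem (Cotangent.isHomogeneous_toPoly _)))
  have h1 : V.OrdAt p 1 (algebraMap ℂ V.FunctionField c) := by
    have := (hf.sub hγ.mem hl1).sub hγ.mem (hc.mono one_le_two)
    convert! this using 1
    ring
  rw [eq_zero_of_ordAt_one hγ.mem h1, map_zero, sub_zero] at hc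
  exact hc

/-! ### The linearization and brackets of leading forms -/

namespace PoissonStructure

variable {π : V.PoissonStructure}

theorem bracket_bind₁ (g : V.FunctionField) (F : MvPolynomial (Fin n) ℂ) :
    π.bracket g (V.ofPoly (MvPolynomial.bind₁ t F)) =
      ∑ a, V.ofPoly (MvPolynomial.bind₁ t (MvPolynomial.pderiv a F)) *
        π.bracket g (V.ofPoly (t a)) := by
  induction F using MvPolynomial.induction_on with
  | C c => simp [ofPoly_C, bracket_algebraMap]
  | add F G hF hG => simp only [map_add, ofPoly_add, hF, hG, add_mul, Finset.sum_add_distrib]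
  | mul_X F j hF =>
    simp only [map_mul, MvPolynomial.bind₁_X_right, ofPoly_mul, π.leibniz, hF, Derivation.leibniz,
      MvPolynomial.pderiv_X, smul_eq_mul, map_add, ofPoly_add, add_mul, Finset.sum_add_distrib]
    rw [add_comm]
    congr 1
    · rw [Finset.sum_eq_single j]
      · simp
      · intro b _ hb
        simp [Pi.single_eq_of_ne hb.symm]
      · simp
    · rw [Finset.sum_mul]
      refine Finset.sum_congr rfl fun a _ => ?_
      ring

theorem bracket_bind₁_bind₁ (F G : MvPolynomial (Fin n) ℂ) :
    π.bracket (V.ofPoly (MvPolynomial.bind₁ t F)) (V.ofPoly (MvPolynomial.bind₁ t G)) =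
      ∑ a, ∑ b, V.ofPoly (MvPolynomial.bind₁ t (MvPolynomial.pderiv a F)) *
        V.ofPoly (MvPolynomial.bind₁ t (MvPolynomial.pderiv b G)) *
          π.bracket (V.ofPoly (t a)) (V.ofPoly (t b)) := by
  rw [bracket_bind₁, Finset.sum_comm]
  refine Finset.sum_congr rfl fun b _ => ?_
  rw [π.bracket_swap (V.ofPoly (t b)), bracket_bind₁, ← Finset.sum_neg_distrib, Finset.mul_sum]
  refine Finset.sum_congr rfl fun a _ => ?_
  rw [π.bracket_swap (V.ofPoly (t a))]
  ring

/-- The differential at `p` of the bracket of two local parameters. -/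
noncomputable def structureForm (π : V.PoissonStructure) (γ : (Fin n → ℂ) → (Fin N → ℂ))
    (t : Fin n → MvPolynomial (Fin N) ℂ) (a b : Fin n) : Cotangent n :=
  fderiv ℂ (V.inCoord γ (π.bracket (V.ofPoly (t a)) (V.ofPoly (t b)))) 0

/-- Replace `g` by its first order expansion: constants have zero bracket, and a remainder of order
two keeps order two because `π` vanishes at `p`, so it has no differential. -/
theorem VanishesAt.fderiv_bracket_right (h0 : π.VanishesAt p) (hγ : V.IsCoordinateSystem p γ)
    (ht : V.IsParameterSystem p γ t) {f g : V.FunctionField} (hf : V.RegularAt f p)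
    (hg : V.RegularAt g p) :
    fderiv ℂ (V.inCoord γ (π.bracket f g)) 0 = ∑ b, fderiv ℂ (V.inCoord γ g) 0 (Pi.single b 1) •
      fderiv ℂ (V.inCoord γ (π.bracket f (V.ofPoly (t b)))) 0 := by
  obtain ⟨c, hc⟩ := ht.ordAt_sub_linearPart hγ hg
  have h1 := h0.ordAt_right hγ.mem hf hc
  simp only [map_sub, bracket_algebraMap, sub_zero, map_sum, map_smul] at h1
  have hreg : ∀ b, V.RegularAt (π.bracket f (V.ofPoly (t b))) p := fun b =>
    regularAt_bracket hγ.mem hf (regularAt_ofPoly _ _)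
  have hs := hγ.fderiv_inCoord_sum Finset.univ fun b =>
    ((hreg b).ordAt.smul (fderiv ℂ (V.inCoord γ g) 0 (Pi.single b 1))).regularAt
  rw [hγ.fderiv_inCoord_congr hs.1 h1, hs.2]
  exact Finset.sum_congr rfl fun b _ => hγ.fderiv_inCoord_smul _ (hreg b)

theorem fderiv_bracket_swap (hγ : V.IsCoordinateSystem p γ)
    {f g : V.FunctionField} (hf : V.RegularAt f p) (hg : V.RegularAt g p) :
    fderiv ℂ (V.inCoord γ (π.bracket g f)) 0 = -fderiv ℂ (V.inCoord γ (π.bracket f g)) 0 := by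
  have h := hγ.fderiv_inCoord_smul (-1) (regularAt_bracket (π := π) hγ.mem hf hg)
  rw [neg_one_smul, ← π.bracket_swap] at h
  rw [h]
  ext v
  simp

theorem VanishesAt.fderiv_bracket (h0 : π.VanishesAt p) (hγ : V.IsCoordinateSystem p γ)
    (ht : V.IsParameterSystem p γ t) {f g : V.FunctionField} (hf : V.RegularAt f p)
    (hg : V.RegularAt g p) :
    fderiv ℂ (V.inCoord γ (π.bracket f g)) 0 = ∑ a, ∑ b,
      (fderiv ℂ (V.inCoord γ f) 0 (Pi.single a 1) * fderiv ℂ (V.inCoord γ g) 0 (Pi.single b 1)) •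
        structureForm π γ t a b := by
  rw [h0.fderiv_bracket_right hγ ht hf hg, Finset.sum_comm]
  refine Finset.sum_congr rfl fun b _ => ?_
  rw [fderiv_bracket_swap hγ (regularAt_ofPoly _ _) hf,
    h0.fderiv_bracket_right hγ ht (regularAt_ofPoly _ _) hf, ← Finset.sum_neg_distrib,
    Finset.smul_sum]
  refine Finset.sum_congr rfl fun a _ => ?_
  rw [structureForm, fderiv_bracket_swap hγ (regularAt_ofPoly (t b) p) (regularAt_ofPoly (t a) p),
    mul_comm, mul_smul, smul_neg, smul_neg, smul_neg]

/-- `linearization` is a choice by `Classical.epsilon`, so a witness is required: the bilinear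
bracket whose structure constants are the differentials of the brackets of the parameters. -/
theorem VanishesAt.isLinearization (h0 : π.VanishesAt p) (hγ : V.IsCoordinateSystem p γ)
    (ht : V.IsParameterSystem p γ t) : π.IsLinearization p γ (π.linearization p γ) := by
  refine Classical.epsilon_spec (p := π.IsLinearization p γ) ⟨LinearMap.mk₂ ℂ (fun ξ η => ∑ a, ∑ b,
    (ξ (Pi.single a 1) * η (Pi.single b 1)) • structureForm π γ t a b) ?_ ?_ ?_ ?_,
      fun f g hf hg => ?_⟩
  · intro ξ ξ' η
    ext v
    simp only [_root_.add_apply, _root_.sum_apply, _root_.smul_apply, smul_eq_mul, add_mul,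
      Finset.sum_add_distrib]
  · intro c ξ η
    simp only [_root_.smul_apply, smul_eq_mul, mul_assoc, Finset.smul_sum, smul_smul]
  · intro ξ η η'
    ext v
    simp only [_root_.add_apply, _root_.sum_apply, _root_.smul_apply, smul_eq_mul, mul_add, add_mul,
      Finset.sum_add_distrib]
  · intro c ξ η
    simp only [_root_.smul_apply, smul_eq_mul, mul_left_comm, Finset.smul_sum, smul_smul]
  · exact (h0.fderiv_bracket hγ ht hf hg).symm

theorem VanishesAt.linearization_apply (h0 : π.VanishesAt p) (hγ : V.IsCoordinateSystem p γ)
    (ht : V.IsParameterSystem p γ t) (a b : Fin n) :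
    π.linearization p γ (ContinuousLinearMap.proj a) (ContinuousLinearMap.proj b) =
      structureForm π γ t a b := by
  have := h0.isLinearization hγ ht _ _ (regularAt_ofPoly (t a) p) (regularAt_ofPoly (t b) p)
  rwa [ht.fderiv_inCoord hγ, ht.fderiv_inCoord hγ] at this

/-- The Poisson bracket of polynomials with respect to the linearization, as a polynomial. -/
noncomputable def leadingBracket (π : V.PoissonStructure) (γ : (Fin n → ℂ) → (Fin N → ℂ))
    (t : Fin n → MvPolynomial (Fin N) ℂ) (F G : MvPolynomial (Fin n) ℂ) : MvPolynomial (Fin n) ℂ :=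
  ∑ a, ∑ b, MvPolynomial.pderiv a F * MvPolynomial.pderiv b G *
    Cotangent.toPoly (structureForm π γ t a b)

theorem VanishesAt.polyBracket_eq (h0 : π.VanishesAt p) (hγ : V.IsCoordinateSystem p γ)
    (ht : V.IsParameterSystem p γ t) (F G : MvPolynomial (Fin n) ℂ) (v : Fin n → ℂ) :
    polyBracket (π.linearization p γ) F G v =
      MvPolynomial.eval v (leadingBracket π γ t F G) := by
  rw [polyBracket, polyD_eq_sum, polyD_eq_sum, bivectorAt, LinearMap.compr₂_apply]
  simp only [map_sum, map_smul, LinearMap.sum_apply, LinearMap.smul_apply,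
    h0.linearization_apply hγ ht, leadingBracket, map_mul, Cotangent.eval_toPoly, Finset.smul_sum,
    smul_eq_mul]
  rw [Finset.sum_comm]
  refine Finset.sum_congr rfl fun a _ => Finset.sum_congr rfl fun b _ => ?_
  change _ * (_ * structureForm π γ t _ _ v) = _
  ring

/-- The linearized bracket of the leading forms is the degree `j + k - 1` part of `{f, g}`, but a
log-canonical bracket is a multiple of `f g` and starts in degree `j + k`. -/
theorem VanishesAt.leadingBracket_eq_zero (h0 : π.VanishesAt p) (hγ : V.IsCoordinateSystem p γ)
    (ht : V.IsParameterSystem p γ t) {f g : V.FunctionField} (hfg : π.LogCan f g) {j k : ℕ}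
    {F G : MvPolynomial (Fin n) ℂ} (hF : F.IsHomogeneous j) (hG : G.IsHomogeneous k)
    (hf : V.OrdAt p (j + 1) (f - V.ofPoly (MvPolynomial.bind₁ t F)))
    (hg : V.OrdAt p (k + 1) (g - V.ofPoly (MvPolynomial.bind₁ t G))) :
    leadingBracket π γ t F G = 0 := by
  -- Constant leading forms are treated apart, since the truncated degrees `j - 1` and `k - 1` below
  -- are correct only for positive `j` and `k`.
  rcases Nat.eq_zero_or_pos j with rfl | hj
  · simp [leadingBracket, IsHomogeneous.pderiv_eq_zero hF]
  rcases Nat.eq_zero_or_pos k with rfl | hk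
  · simp [leadingBracket, IsHomogeneous.pderiv_eq_zero hG]
  have hhom : (leadingBracket π γ t F G).IsHomogeneous (j + k - 1) := by
    refine MvPolynomial.IsHomogeneous.sum _ _ _ fun a _ =>
      MvPolynomial.IsHomogeneous.sum _ _ _ fun b _ => ?_
    have := (hF.pderiv (i := a)).mul (hG.pderiv (i := b)) |>.mul
      (Cotangent.isHomogeneous_toPoly (structureForm π γ t a b))
    rwa [show j - 1 + (k - 1) + 1 = j + k - 1 by omega] at this
  refine ht.eq_zero_of_ordAt hγ hhom ?_
  rw [show j + k - 1 + 1 = j + k by omega]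
  have hp := hγ.mem
  set f₀ := V.ofPoly (MvPolynomial.bind₁ t F) with hf₀
  set g₀ := V.ofPoly (MvPolynomial.bind₁ t G) with hg₀
  have hFo : V.OrdAt p j f₀ := ordAt_ofPoly (Ideal.mem_sup_left (bind₁_mem_pow ht.mem hF))
  have hGo : V.OrdAt p k g₀ := ordAt_ofPoly (Ideal.mem_sup_left (bind₁_mem_pow ht.mem hG))
  have hfo : V.OrdAt p j f := by
    simpa using (hf.mono (Nat.le_succ j)).add hp hFo
  have hgo : V.OrdAt p k g := by
    simpa using (hg.mono (Nat.le_succ k)).add hp hGo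
  have h1 : V.OrdAt p (j + k) (π.bracket f g) := by
    obtain ⟨c, hc⟩ := hfg
    rw [hc]
    exact (hfo.mul hgo).smul c
  have h2 : V.OrdAt p (j + k) (π.bracket (f - f₀) g) :=
    (h0.ordAt_bracket hp hf hgo).mono (by omega)
  have h3 : V.OrdAt p (j + k) (π.bracket f₀ (g - g₀)) :=
    (h0.ordAt_bracket hp hFo hg).mono (by omega)
  have h4 : V.OrdAt p (j + k) (π.bracket f₀ g₀) := by
    have := (h1.sub hp h2).sub hp h3
    simpa using this
  -- By the chain rule only the brackets of parameters have to be replaced by their linear parts;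
  -- the error has order `(j - 1) + (k - 1) + 2`.
  have h5 : V.OrdAt p (j + k) (π.bracket f₀ g₀ -
      V.ofPoly (MvPolynomial.bind₁ t (leadingBracket π γ t F G))) := by
    rw [hf₀, hg₀, bracket_bind₁_bind₁]
    simp only [leadingBracket, map_sum, map_mul, ofPoly_sum, ofPoly_mul]
    rw [← Finset.sum_sub_distrib]
    refine OrdAt.sum hp fun a _ => ?_
    rw [← Finset.sum_sub_distrib]
    refine OrdAt.sum hp fun b _ => ?_
    rw [← mul_sub]
    have ha : V.OrdAt p (j - 1) (V.ofPoly (MvPolynomial.bind₁ t (MvPolynomial.pderiv a F))) :=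
      ordAt_ofPoly (Ideal.mem_sup_left (bind₁_mem_pow ht.mem hF.pderiv))
    have hb : V.OrdAt p (k - 1) (V.ofPoly (MvPolynomial.bind₁ t (MvPolynomial.pderiv b G))) :=
      ordAt_ofPoly (Ideal.mem_sup_left (bind₁_mem_pow ht.mem hG.pderiv))
    exact ((ha.mul hb).mul (ht.ordAt_sub_of_ordAt_one hγ
      (h0.ordAt_one hp (regularAt_ofPoly (t a) p) (regularAt_ofPoly (t b) p)))).mono (by omega)
  simpa using h4.sub hp h5

end PoissonStructure

end QuasiAffineVariety

end ClusterPoisson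

namespace ClusterPoisson

/-! ### Top degree forms and Jacobian determinants -/

section Wedge

variable {k K R : Type*} [Field k] [Field K] [Algebra k K] [CommRing R] [Algebra k R] [Algebra K R]
  [IsScalarTower k K R] {n : ℕ}

/-- The Jacobian determinant with respect to `n` derivations, as an alternating map on
differentials. -/
noncomputable def jacobianAlternating (δ : Fin n → Derivation k K R) : Ω[K⁄k] [⋀^Fin n]→ₗ[K] R :=
  AlternatingMap.compLinearMap
    { (Matrix.detRowAlternating (R := R) (n := Fin n)).toMultilinearMap.restrictScalars K with
      map_eq_zero_of_eq' := fun v _ _ h hij =>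
        (Matrix.detRowAlternating (R := R) (n := Fin n)).map_eq_zero_of_eq v h hij }
    (LinearMap.pi fun j => (δ j).liftKaehlerDifferential)

theorem jacobianAlternating_D (δ : Fin n → Derivation k K R) (b : Fin n → K) :
    jacobianAlternating δ (fun i => KaehlerDifferential.D k K (b i)) =
      (Matrix.of fun i j => δ j (b i)).det := by
  change Matrix.det (fun i j => (δ j).liftKaehlerDifferential (KaehlerDifferential.D k K (b i))) = _
  simp only [Derivation.liftKaehlerDifferential_comp_D]
  rfl

/-- The Jacobian factors through the exterior power. The derivations take values in a mere
`K`-algebra `R`, so that germs of functions are allowed. -/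
theorem jacobian_eq_of_wedge_eq (δ : Fin n → Derivation k K R) {u w : K} {b c : Fin n → K}
    (h : u • exteriorPower.ιMulti K n (fun i => KaehlerDifferential.D k K (b i)) =
      w • exteriorPower.ιMulti K n (fun i => KaehlerDifferential.D k K (c i))) :
    algebraMap K R u * (Matrix.of fun i j => δ j (b i)).det =
      algebraMap K R w * (Matrix.of fun i j => δ j (c i)).det := by
  have := congrArg (exteriorPower.alternatingMapLinearEquiv (jacobianAlternating δ)) h
  simpa only [map_smul, exteriorPower.alternatingMapLinearEquiv_apply_ιMulti,
    jacobianAlternating_D, Algebra.smul_def] using this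

end Wedge

/-! ### Coefficients of rational forms in local coordinates, off a proper zero set -/

namespace QuasiAffineVariety

variable {N : ℕ} {V : QuasiAffineVariety N} {p : Fin N → ℂ} {n : ℕ}
  {γ : (Fin n → ℂ) → (Fin N → ℂ)} {t : Fin n → MvPolynomial (Fin N) ℂ}

/-- The sets which contain, near `0`, the complement of the zero set of a nonzero regular
function. -/
def genericFilter (hγ : V.IsCoordinateSystem p γ) : Filter (Fin n → ℂ) where
  sets := {s | ∃ f : V.FunctionField, f ≠ 0 ∧ V.RegularAt f p ∧
    ∀ᶠ z in 𝓝 0, V.inCoord γ f z ≠ 0 → z ∈ s}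
  univ_sets := ⟨1, one_ne_zero, by simpa using regularAt_ofPoly (V := V) 1 p, by simp⟩
  sets_of_superset := by
    rintro s s' ⟨f, hf0, hf, h⟩ hs
    exact ⟨f, hf0, hf, h.mono fun z hz hfz => hs (hz hfz)⟩
  inter_sets := by
    rintro s s' ⟨f, hf0, hf, h⟩ ⟨f', hf0', hf', h'⟩
    refine ⟨f * f', mul_ne_zero hf0 hf0', hf.mul hf', ?_⟩
    filter_upwards [h, h', hγ.inCoord_mul hf hf'] with z hz hz' hm hne
    rw [hm, Pi.mul_apply, mul_ne_zero_iff] at hne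
    exact ⟨hz hne.1, hz' hne.2⟩

theorem genericFilter_le (hγ : V.IsCoordinateSystem p γ) : genericFilter hγ ≤ 𝓝 0 := fun _ hs =>
  ⟨1, one_ne_zero, by simpa using regularAt_ofPoly (V := V) 1 p, by
    filter_upwards [hs] with z hz _ using hz⟩

/-- The rational function `f` is regular along the coordinate system at and near `γ z`. -/
structure GoodAt (V : QuasiAffineVariety N) (γ : (Fin n → ℂ) → (Fin N → ℂ)) (f : V.FunctionField)
    (z : Fin n → ℂ) : Prop where
  mem : ∀ᶠ z' in 𝓝 z, γ z' ∈ V.carrier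
  regular : ∀ᶠ z' in 𝓝 z, V.RegularAt f (γ z')
  differentiable : DifferentiableAt ℂ (V.inCoord γ f) z

/-- It suffices to stay off the zeros of a denominator of `f`. The generic filter thus accommodates
rational functions with poles through `p`, which the whole function field contains. -/
theorem eventually_goodAt (hγ : V.IsCoordinateSystem p γ) (f : V.FunctionField) :
    ∀ᶠ z in genericFilter hγ, V.GoodAt γ f z := by
  obtain ⟨a, b, hb0, rfl⟩ := exists_ofPoly_div f
  refine ⟨V.ofPoly b, hb0, regularAt_ofPoly b p, ?_⟩
  filter_upwards [hγ.eventually_mem.eventually_nhds, hγ.analytic.eventually_analyticAt,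
    hγ.inCoord_ofPoly b] with z hz hza hzb hne
  rw [hzb] at hne
  have hd : ∀ c : MvPolynomial (Fin N) ℂ,
      DifferentiableAt ℂ (fun z => MvPolynomial.eval (γ z) c) z := fun c =>
    ((ClusterPoisson.hasFDerivAt_eval c (γ z)).differentiableAt).comp z hza.differentiableAt
  have hne' : ∀ᶠ z' in 𝓝 z, MvPolynomial.eval (γ z') b ≠ 0 :=
    (hd b).continuousAt.eventually_ne hne
  refine ⟨hz, hne'.mono fun z' hz' => ⟨(a, b), hz', rfl⟩, ?_⟩
  refine DifferentiableAt.congr_of_eventuallyEq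
    (f := fun z => MvPolynomial.eval (γ z) a * (MvPolynomial.eval (γ z) b)⁻¹) ?_ ?_
  · exact (hd a).mul ((hd b).inv hne)
  · filter_upwards [hz, hne'] with z' hz' hb'
    rw [← div_eq_mul_inv]
    exact value_div hz' hb'

/-- Germs of functions along the generic filter. -/
def GenericGerm (hγ : V.IsCoordinateSystem p γ) : Type := Filter.Germ (genericFilter hγ) ℂ

noncomputable instance (hγ : V.IsCoordinateSystem p γ) : CommRing (GenericGerm hγ) :=
  inferInstanceAs (CommRing (Filter.Germ (genericFilter hγ) ℂ))

/-- The germ of a function. -/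
noncomputable def toGenericGerm (hγ : V.IsCoordinateSystem p γ) :
    ((Fin n → ℂ) → ℂ) →+* GenericGerm hγ :=
  Filter.Germ.coeRingHom (genericFilter hγ)

theorem toGenericGerm_eq_iff {hγ : V.IsCoordinateSystem p γ} {g h : (Fin n → ℂ) → ℂ} :
    toGenericGerm hγ g = toGenericGerm hγ h ↔ ∀ᶠ z in genericFilter hγ, g z = h z :=
  Filter.Germ.coe_eq

/-- Rational functions as generic germs. -/
noncomputable def inCoordGerm (hγ : V.IsCoordinateSystem p γ) :
    V.FunctionField →+* GenericGerm hγ where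
  toFun f := toGenericGerm hγ (V.inCoord γ f)
  map_one' := by
    rw [← map_one (toGenericGerm hγ), toGenericGerm_eq_iff]
    have := hγ.inCoord_algebraMap 1
    rw [map_one] at this
    exact this.filter_mono (genericFilter_le hγ)
  map_zero' := by
    rw [← map_zero (toGenericGerm hγ), toGenericGerm_eq_iff]
    have := hγ.inCoord_algebraMap 0
    rw [map_zero] at this
    exact this.filter_mono (genericFilter_le hγ)
  map_mul' f g := by
    rw [← map_mul, toGenericGerm_eq_iff]
    filter_upwards [eventually_goodAt hγ f, eventually_goodAt hγ g] with z hf hg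
    exact value_mul hf.mem.self_of_nhds hf.regular.self_of_nhds hg.regular.self_of_nhds
  map_add' f g := by
    rw [← map_add, toGenericGerm_eq_iff]
    filter_upwards [eventually_goodAt hγ f, eventually_goodAt hγ g] with z hf hg
    exact value_add hf.mem.self_of_nhds hf.regular.self_of_nhds hg.regular.self_of_nhds

noncomputable instance (hγ : V.IsCoordinateSystem p γ) : Algebra V.FunctionField (GenericGerm hγ) :=
  (inCoordGerm hγ).toAlgebra

noncomputable instance (hγ : V.IsCoordinateSystem p γ) : Algebra ℂ (GenericGerm hγ) :=
  ((inCoordGerm hγ).comp (algebraMap ℂ V.FunctionField)).toAlgebra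

instance (hγ : V.IsCoordinateSystem p γ) : IsScalarTower ℂ V.FunctionField (GenericGerm hγ) :=
  IsScalarTower.of_algebraMap_eq fun _ => rfl

theorem smul_genericGerm (hγ : V.IsCoordinateSystem p γ) (f : V.FunctionField)
    (h : (Fin n → ℂ) → ℂ) :
    f • toGenericGerm hγ h = toGenericGerm hγ (V.inCoord γ f * h) := by
  rw [Algebra.smul_def, map_mul]
  rfl

theorem GoodAt.fderiv_add {f g : V.FunctionField} {z : Fin n → ℂ} (hf : V.GoodAt γ f z)
    (hg : V.GoodAt γ g z) : fderiv ℂ (V.inCoord γ (f + g)) z =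
      fderiv ℂ (V.inCoord γ f) z + fderiv ℂ (V.inCoord γ g) z := by
  have h : V.inCoord γ (f + g) =ᶠ[𝓝 z] V.inCoord γ f + V.inCoord γ g := by
    filter_upwards [hf.mem, hf.regular, hg.regular] with z' h1 h2 h3 using value_add h1 h2 h3
  rw [h.fderiv_eq, _root_.fderiv_add hf.differentiable hg.differentiable]

theorem GoodAt.fderiv_mul {f g : V.FunctionField} {z : Fin n → ℂ} (hf : V.GoodAt γ f z)
    (hg : V.GoodAt γ g z) : fderiv ℂ (V.inCoord γ (f * g)) z =
      V.inCoord γ f z • fderiv ℂ (V.inCoord γ g) z +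
        V.inCoord γ g z • fderiv ℂ (V.inCoord γ f) z := by
  have h : V.inCoord γ (f * g) =ᶠ[𝓝 z] V.inCoord γ f * V.inCoord γ g := by
    filter_upwards [hf.mem, hf.regular, hg.regular] with z' h1 h2 h3 using value_mul h1 h2 h3
  rw [h.fderiv_eq, _root_.fderiv_mul hf.differentiable hg.differentiable]

/-- The partial derivative with respect to a coordinate, on rational functions. -/
noncomputable def coordDerivation (hγ : V.IsCoordinateSystem p γ) (j : Fin n) :
    Derivation ℂ V.FunctionField (GenericGerm hγ) :=
  Derivation.mk'
    { toFun := fun f => toGenericGerm hγ fun z => fderiv ℂ (V.inCoord γ f) z (Pi.single j 1)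
      map_add' := fun f g => by
        rw [← map_add, toGenericGerm_eq_iff]
        filter_upwards [eventually_goodAt hγ f, eventually_goodAt hγ g] with z hf hg
        rw [hf.fderiv_add hg]
        rfl
      map_smul' := fun c f => by
        rw [RingHom.id_apply, ← algebraMap_smul V.FunctionField c (toGenericGerm hγ _),
          smul_genericGerm, toGenericGerm_eq_iff]
        filter_upwards [eventually_goodAt hγ f, eventually_goodAt hγ (algebraMap ℂ _ c)] with z hf hc
        have h0 : V.inCoord γ (algebraMap ℂ V.FunctionField c) =ᶠ[𝓝 z] fun _ => c := by
          filter_upwards [hf.mem] with z' hz' using value_algebraMap hz' c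
        rw [Algebra.smul_def, hc.fderiv_mul hf, h0.fderiv_eq]
        simp }
    fun f g => by
      change toGenericGerm hγ _ = f • toGenericGerm hγ _ + g • toGenericGerm hγ _
      rw [smul_genericGerm, smul_genericGerm, ← map_add, toGenericGerm_eq_iff]
      filter_upwards [eventually_goodAt hγ f, eventually_goodAt hγ g] with z hf hg
      rw [hf.fderiv_mul hg]
      rfl

theorem algebraMap_mul_det_coordDerivation (hγ : V.IsCoordinateSystem p γ) (u : V.FunctionField)
    (b : Fin n → V.FunctionField) :
    algebraMap V.FunctionField (GenericGerm hγ) u *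
      (Matrix.of fun i j => coordDerivation hγ j (b i)).det =
      toGenericGerm hγ (V.coeffInCoord γ u b) := by
  have h1 : (Matrix.of fun i j => coordDerivation hγ j (b i)) =
      (toGenericGerm hγ).mapMatrix
        (Matrix.of fun i j z => fderiv ℂ (V.inCoord γ (b i)) z (Pi.single j 1)) := rfl
  rw [h1, ← RingHom.map_det]
  change toGenericGerm hγ (V.inCoord γ u) * _ = _
  rw [← map_mul]
  congr 1
  funext z
  rw [Pi.mul_apply, coeffInCoord]
  exact congrArg _ ((Pi.evalRingHom (fun _ : Fin n → ℂ => ℂ) z).map_det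
    (Matrix.of fun i j z => fderiv ℂ (V.inCoord γ (b i)) z (Pi.single j 1)))

/-- Equal rational forms have equal coefficients in local coordinates, generically. -/
theorem eventually_coeffInCoord_eq (hγ : V.IsCoordinateSystem p γ) {u w : V.FunctionField}
    {b c : Fin n → V.FunctionField} (h : u • V.wedgeD b = w • V.wedgeD c) :
    ∀ᶠ z in genericFilter hγ, V.coeffInCoord γ u b z = V.coeffInCoord γ w c z := by
  rw [← toGenericGerm_eq_iff, ← algebraMap_mul_det_coordDerivation,
    ← algebraMap_mul_det_coordDerivation]
  exact jacobian_eq_of_wedge_eq (coordDerivation hγ) h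

end QuasiAffineVariety

end ClusterPoisson

namespace ClusterPoisson

/-! ### Expansions along lines -/

section Lines

open Asymptotics

variable {n : ℕ}

theorem isBigO_pow_pow_punctured {j k : ℕ} (hjk : j ≤ k) :
    (fun s : ℂ => s ^ k) =O[𝓝[≠] 0] fun s => s ^ j := by
  rcases hjk.eq_or_lt with rfl | h
  · exact isBigO_refl _ _
  · exact ((isLittleO_pow_pow h).mono nhdsWithin_le_nhds).isBigO

/-- The function `x` of one variable is `a * s ^ k` up to terms of higher order. -/
def HasLineTerm (x : ℂ → ℂ) (a : ℂ) (k : ℕ) : Prop :=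
  (fun s => x s - a * s ^ k) =O[𝓝[≠] 0] fun s => s ^ (k + 1)

theorem HasLineTerm.isBigO {x : ℂ → ℂ} {a : ℂ} {k : ℕ} (h : HasLineTerm x a k) :
    x =O[𝓝[≠] 0] fun s => s ^ k := by
  refine ((IsBigO.trans h (isBigO_pow_pow_punctured (Nat.le_succ k))).add
    (isBigO_const_mul_self a (fun s : ℂ => s ^ k) _)).congr_left fun s => ?_
  ring

theorem HasLineTerm.mul {x y : ℂ → ℂ} {a b : ℂ} {j k : ℕ} (hx : HasLineTerm x a j)
    (hy : HasLineTerm y b k) : HasLineTerm (fun s => x s * y s) (a * b) (j + k) := by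
  have h1 := (IsBigO.mul hx hy.isBigO).congr_right (g₂ := fun s : ℂ => s ^ (j + k + 1))
    fun s => by ring
  have h2 := ((isBigO_const_mul_self a (fun s : ℂ => s ^ j) _).mul hy).congr_right
    (g₂ := fun s : ℂ => s ^ (j + k + 1)) fun s => by ring
  refine (h1.add h2).congr_left fun s => ?_
  ring

theorem HasLineTerm.prod {ι : Type*} (T : Finset ι) {x : ι → ℂ → ℂ} {a : ι → ℂ} {k : ι → ℕ}
    (h : ∀ i, HasLineTerm (x i) (a i) (k i)) :
    HasLineTerm (fun s => ∏ i ∈ T, x i s) (∏ i ∈ T, a i) (∑ i ∈ T, k i) := by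
  classical
  induction T using Finset.induction_on with
  | empty => simpa [HasLineTerm] using isBigO_zero (E' := ℂ) (fun s : ℂ => s) (𝓝[≠] 0)
  | insert i T hi ih =>
    simp only [Finset.prod_insert hi, Finset.sum_insert hi]
    exact (h i).mul ih

theorem IsLowestTerm.hasLineTerm {h : (Fin n → ℂ) → ℂ} {F : MvPolynomial (Fin n) ℂ} {e : ℕ}
    (hF : IsLowestTerm h F e) (v : Fin n → ℂ) :
    HasLineTerm (fun s => h (s • v)) (MvPolynomial.eval v F) e := by
  refine (IsBigO.comp_line hF.2.2 v).congr_left fun s => ?_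
  rw [eval_smul_of_isHomogeneous hF.2.1, mul_comm]

/-- Cauchy's estimate for the derivative of a holomorphic function vanishing to a given order. -/
theorem isBigO_fderiv_line {h : (Fin n → ℂ) → ℂ} {k : ℕ} (hh : AnalyticAt ℂ h 0)
    (hO : h =O[𝓝 0] fun z => ‖z‖ ^ (k + 1)) (v u : Fin n → ℂ) :
    (fun s : ℂ => fderiv ℂ h (s • v) u) =O[𝓝[≠] 0] fun s => s ^ k := by
  obtain ⟨C, hC⟩ := hO.bound
  obtain ⟨r, hr, hball⟩ := Metric.eventually_nhds_iff_ball.mp (hC.and hh.eventually_analyticAt)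
  have hC0 : 0 ≤ |C| := abs_nonneg C
  set B := ‖v‖ + ‖u‖ with hB
  have hB0 : 0 ≤ B := by positivity
  refine IsBigO.of_bound (|C| * B ^ (k + 1)) ?_
  have hsmall : ∀ᶠ s : ℂ in 𝓝[≠] 0, ‖s‖ * B < r := by
    have hc : Continuous fun s : ℂ => ‖s‖ * B := by fun_prop
    have ht : Filter.Tendsto (fun s : ℂ => ‖s‖ * B) (𝓝 0) (𝓝 0) := by simpa using hc.tendsto 0
    exact (ht.eventually_lt_const hr).filter_mono nhdsWithin_le_nhds
  filter_upwards [hsmall, self_mem_nhdsWithin] with s hs hs0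
  have hspos : 0 < ‖s‖ := norm_pos_iff.mpr hs0
  have hnorm : ∀ w ∈ Metric.closedBall (0 : ℂ) ‖s‖, ‖s • v + w • u‖ ≤ ‖s‖ * B := fun w hw => by
    rw [mem_closedBall_zero_iff] at hw
    calc ‖s • v + w • u‖ ≤ ‖s‖ * ‖v‖ + ‖w‖ * ‖u‖ := by
          rw [← norm_smul, ← norm_smul]
          exact norm_add_le _ _
      _ ≤ ‖s‖ * ‖v‖ + ‖s‖ * ‖u‖ := by gcongr
      _ = ‖s‖ * B := by rw [hB, mul_add]
  have hmem : ∀ w ∈ Metric.closedBall (0 : ℂ) ‖s‖, s • v + w • u ∈ Metric.ball (0 : Fin n → ℂ) r :=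
    fun w hw => mem_ball_zero_iff.mpr ((hnorm w hw).trans_lt hs)
  have hline : ∀ w : ℂ, HasDerivAt (fun w : ℂ => s • v + w • u) u w := fun w => by
    simpa using ((hasDerivAt_id w).smul_const u).const_add (s • v)
  have hder : ∀ w ∈ Metric.closedBall (0 : ℂ) ‖s‖,
      HasDerivAt (fun w : ℂ => h (s • v + w • u)) (fderiv ℂ h (s • v + w • u) u) w := fun w hw =>
    (hball _ (hmem w hw)).2.differentiableAt.hasFDerivAt.comp_hasDerivAt w (hline w)
  have hdiff : DiffContOnCl ℂ (fun w : ℂ => h (s • v + w • u)) (Metric.ball 0 ‖s‖) := by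
    refine DifferentiableOn.diffContOnCl fun w hw => ?_
    rw [closure_ball _ hspos.ne'] at hw
    exact (hder w hw).differentiableAt.differentiableWithinAt
  -- Cauchy on the disc of radius `‖s‖` about `s • v` in direction `u`: there `h` is of size `‖s‖ ^
  -- (k + 1)`, and dividing by the radius costs one power.
  have hest := Complex.norm_deriv_le_of_forall_mem_sphere_norm_le hspos hdiff
    (C := |C| * (‖s‖ * B) ^ (k + 1)) fun w hw => by
      have hw' := Metric.sphere_subset_closedBall hw
      refine ((hball _ (hmem w hw')).1).trans ?_
      rw [Real.norm_of_nonneg (by positivity)]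
      have := hnorm w hw'
      gcongr
      exact le_abs_self C
  rw [(hder 0 (Metric.mem_closedBall_self hspos.le)).deriv] at hest
  simp only [zero_smul, add_zero] at hest
  refine hest.trans (le_of_eq ?_)
  rw [norm_pow]
  field_simp
  ring_nf

theorem polyD_apply_single (F : MvPolynomial (Fin n) ℂ) (v : Fin n → ℂ) (j : Fin n) :
    polyD F v (Pi.single j 1) = MvPolynomial.eval v (MvPolynomial.pderiv j F) := by
  rw [polyD_eq]
  exact diffAt_single F j

/-- The extra factor `s` restores the degree lost by differentiation and so avoids the exponent `e -
1` when `e = 0`. -/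
theorem mul_polyD_smul {F : MvPolynomial (Fin n) ℂ} {e : ℕ} (hF : F.IsHomogeneous e)
    (v : Fin n → ℂ) (j : Fin n) (s : ℂ) :
    s * polyD F (s • v) (Pi.single j 1) = s ^ e * polyD F v (Pi.single j 1) := by
  rw [polyD_apply_single, polyD_apply_single]
  rcases e with _ | e
  · simp [IsHomogeneous.pderiv_eq_zero hF]
  · rw [eval_smul_of_isHomogeneous (hF.pderiv (i := j)), Nat.add_sub_cancel]
    ring

theorem IsLowestTerm.hasLineTerm_fderiv {h : (Fin n → ℂ) → ℂ} (hh : AnalyticAt ℂ h 0)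
    {F : MvPolynomial (Fin n) ℂ} {e : ℕ} (hF : IsLowestTerm h F e) (v : Fin n → ℂ) (j : Fin n) :
    HasLineTerm (fun s => s * fderiv ℂ h (s • v) (Pi.single j 1)) (polyD F v (Pi.single j 1)) e := by
  have hFa : AnalyticAt ℂ (fun z => MvPolynomial.eval z F) 0 := analyticAt_eval F 0
  have h1 := isBigO_fderiv_line (hh.sub hFa) hF.2.2 v (Pi.single j 1)
  have h2 := (isBigO_refl (fun s : ℂ => s) (𝓝[≠] 0)).mul h1
  refine h2.congr' ?_ (Filter.Eventually.of_forall fun s => (pow_succ' s e).symm)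
  filter_upwards [(tendsto_smul_line v).eventually hh.eventually_analyticAt] with s hs
  have h3 : fderiv ℂ (h - fun z => MvPolynomial.eval z F) (s • v) =
      fderiv ℂ h (s • v) - polyD F (s • v) :=
    fderiv_sub hs.differentiableAt (analyticAt_eval F (s • v)).differentiableAt
  rw [h3, _root_.sub_apply, mul_sub, mul_polyD_smul hF.2.1]
  ring

theorem isBigO_det {M : Fin n → Fin n → ℂ → ℂ} {m : Fin n → ℕ}
    (hM : ∀ i j, M i j =O[𝓝[≠] 0] fun s => s ^ m i) :
    (fun s => (Matrix.of fun i j => M i j s).det) =O[𝓝[≠] 0] fun s => s ^ ∑ i, m i := by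
  simp only [Matrix.det_apply, Matrix.of_apply]
  refine IsBigO.fun_sum fun σ _ => ?_
  have h1 := IsBigO.finsetProd (s := Finset.univ) fun i _ => hM (σ i) i
  have h2 := h1.congr_right (g₂ := fun s : ℂ => s ^ ∑ i, m i) fun s => by
    rw [Finset.prod_pow_eq_pow_sum, Equiv.sum_comp σ m]
  have h3 := h2.const_mul_left (((Equiv.Perm.sign σ : ℤˣ) : ℤ) : ℂ)
  refine h3.congr_left fun s => ?_
  rw [Units.smul_def, zsmul_eq_mul]

/-- If any `q` rows of the leading coefficients are dependent, then the determinant vanishes to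
higher order than expected. -/
theorem isBigO_det_of_dependent {M : Fin n → Fin n → ℂ → ℂ} {A : Fin n → Fin n → ℂ}
    {e : Fin n → ℕ} {q : ℕ}
    (hA : ∀ T : Finset (Fin n), T.card = q → ¬LinearIndependent ℂ (fun i : T => A i))
    (hM : ∀ i j, HasLineTerm (M i j) (A i j) (e i)) :
    (fun s => (Matrix.of fun i j => M i j s).det) =O[𝓝[≠] 0]
      fun s => s ^ (∑ i, e i + (n + 1 - q)) := by
  classical
  -- Each row is its leading part plus a remainder; the determinant expands over the set `T` of rows
  -- where the leading part is taken.
  set P : ℂ → Fin n → Fin n → ℂ := fun s i j => A i j * s ^ e i with hP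
  set Q : ℂ → Fin n → Fin n → ℂ := fun s i j => M i j s - A i j * s ^ e i with hQ
  have hexp : ∀ s, (Matrix.of fun i j => M i j s).det =
      ∑ T : Finset (Fin n), (Matrix.of (T.piecewise (P s) (Q s))).det := fun s => by
    have h := (Matrix.detRowAlternating (R := ℂ) (n := Fin n)).toMultilinearMap.map_add_univ
      (P s) (Q s)
    have hPQ : P s + Q s = fun i j => M i j s := by
      funext i j
      simp [hP, hQ]
    rw [hPQ] at h
    exact h
  simp only [hexp]
  refine IsBigO.fun_sum fun T _ => ?_
  by_cases hT : q ≤ T.card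
  -- With at least `q` leading rows, some `q` of them are dependent; the nonzero scalars `s ^ e i`
  -- do not matter, and the term is zero.
  · obtain ⟨T', hT', hcard⟩ := Finset.exists_subset_card_eq hT
    refine (isBigO_zero _ _).congr' ?_ .rfl
    filter_upwards [self_mem_nhdsWithin] with s hs
    symm
    refine (Matrix.detRowAlternating (R := ℂ) (n := Fin n)).map_linearDependent _ fun hli => ?_
    refine hA T' hcard ?_
    have h1 := hli.comp (fun i : T' => (i : Fin n)) Subtype.val_injective
    have h2 := h1.units_smul fun i : T' => Units.mk0 ((s ^ e i)⁻¹) (inv_ne_zero (pow_ne_zero _ hs))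
    convert! h2 using 1
    funext i j
    have hi : (i : Fin n) ∈ T := hT' i.2
    have hs' : s ^ e i ≠ 0 := pow_ne_zero _ hs
    change A i j = (s ^ e i)⁻¹ * (T.piecewise (P s) (Q s) i j)
    rw [Finset.piecewise_eq_of_mem _ _ _ hi, hP]
    field_simp
  -- With fewer than `q` leading rows, at least `n + 1 - q` rows are remainders, and each
  -- contributes one more factor `s`.
  · have hentry : ∀ i j, (fun s => T.piecewise (P s) (Q s) i j) =O[𝓝[≠] 0]
        fun s => s ^ (e i + if i ∈ T then 0 else 1) := fun i j => by
      by_cases hi : i ∈ T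
      · simp only [Finset.piecewise_eq_of_mem _ _ _ hi, if_pos hi, add_zero]
        exact isBigO_const_mul_self (A i j) (fun s : ℂ => s ^ e i) _
      · simp only [Finset.piecewise_eq_of_notMem _ _ _ hi, if_neg hi]
        exact hM i j
    refine (isBigO_det hentry).trans (isBigO_pow_pow_punctured ?_)
    rw [Finset.sum_add_distrib]
    refine Nat.add_le_add_left ?_ _
    have hsum : ∑ i, (if i ∈ T then 0 else 1) = n - T.card := by
      rw [Finset.sum_ite, Finset.sum_const_zero, zero_add, Finset.sum_const, smul_eq_mul, mul_one,
        ← Finset.compl_filter, Finset.card_compl, Fintype.card_fin]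
      congr 2
      ext i
      simp
    rw [hsum]
    omega

theorem linearRank_le (L : Cotangent n →ₗ[ℂ] Cotangent n →ₗ[ℂ] Cotangent n) : linearRank L ≤ n := by
  refine ciSup_le' fun v => ?_
  refine (LinearMap.finrank_range_le _).trans (le_of_eq ?_)
  rw [← (LinearMap.toContinuousLinearMap (𝕜 := ℂ) (E := Fin n → ℂ) (F' := ℂ)).finrank_eq]
  change Module.finrank ℂ (Module.Dual ℂ (Fin n → ℂ)) = n
  rw [Subspace.dual_finrank_eq, Module.finrank_fin_fun]

end Lines

/-! ### Lowest degree of a log-volume form and independence of lowest terms -/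

namespace QuasiAffineVariety

open Asymptotics

variable {N : ℕ} {V : QuasiAffineVariety N} {p : Fin N → ℂ} {n : ℕ}
  {γ : (Fin n → ℂ) → (Fin N → ℂ)} {t : Fin n → MvPolynomial (Fin N) ℂ}

theorem IsCoordinateSystem.inCoord_prod (hγ : V.IsCoordinateSystem p γ) {ι : Type*} (T : Finset ι)
    {f : ι → V.FunctionField} (hf : ∀ i, V.RegularAt (f i) p) :
    V.RegularAt (∏ i ∈ T, f i) p ∧
      V.inCoord γ (∏ i ∈ T, f i) =ᶠ[𝓝 0] fun z => ∏ i ∈ T, V.inCoord γ (f i) z := by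
  classical
  induction T using Finset.induction_on with
  | empty =>
    have := hγ.inCoord_algebraMap 1
    rw [map_one] at this
    exact ⟨by simpa using regularAt_ofPoly (V := V) 1 p, by simpa using this⟩
  | insert i T hi ih =>
    simp only [Finset.prod_insert hi]
    refine ⟨(hf i).mul ih.1, ?_⟩
    filter_upwards [hγ.inCoord_mul (hf i) ih.1, ih.2] with z h1 h2
    rw [h1, Pi.mul_apply, h2]

/-- A generic property holds near `0` on generic lines through `0`. -/
theorem exists_eventually_line (hγ : V.IsCoordinateSystem p γ) (ht : V.IsParameterSystem p γ t)
    {P : (Fin n → ℂ) → Prop} (hP : ∀ᶠ z in genericFilter hγ, P z) :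
    ∃ H : MvPolynomial (Fin n) ℂ, H ≠ 0 ∧ ∀ v, MvPolynomial.eval v H ≠ 0 →
      ∀ᶠ s : ℂ in 𝓝[≠] 0, P (s • v) := by
  obtain ⟨f, hf0, hf, h⟩ := hP
  obtain ⟨k, H, hH0, hH, hfH⟩ := ht.exists_leadingForm hγ.mem hf hf0
  refine ⟨H, hH0, fun v hv => ?_⟩
  have hterm := (ht.isLowestTerm hγ hH0 hH hfH).hasLineTerm v
  -- Where the lowest form `H` of `f` is nonzero at `v`, the term `H(v) s ^ k` dominates the
  -- remainder near `s = 0`.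
  have hne : ∀ᶠ s : ℂ in 𝓝[≠] 0, V.inCoord γ f (s • v) ≠ 0 := by
    have hlt : (fun s : ℂ => s ^ (k + 1)) =o[𝓝[≠] 0] fun s => MvPolynomial.eval v H * s ^ k :=
      (((isLittleO_pow_pow (Nat.lt_succ_self k)).mono nhdsWithin_le_nhds)).trans_isBigO
        (isBigO_self_const_mul hv _ _)
    have hb := (hterm.trans_isLittleO hlt).bound (show (0 : ℝ) < 1 / 2 by norm_num)
    filter_upwards [hb, self_mem_nhdsWithin] with s hs hs0 hzero
    have hpos : 0 < ‖MvPolynomial.eval v H * s ^ k‖ :=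
      norm_pos_iff.mpr (mul_ne_zero hv (pow_ne_zero k hs0))
    rw [hzero, zero_sub, norm_neg] at hs
    linarith
  filter_upwards [(tendsto_smul_line v).eventually h, hne] with s hs hs'
  exact hs hs'

theorem HasLowestDegree.neg (hγ : V.IsCoordinateSystem p γ) {ω : V.RationalForm n} {d : ℤ}
    (h : V.HasLowestDegree p γ ω d) : V.HasLowestDegree p γ (-ω) d := by
  obtain ⟨F, G, e, e', ⟨a, g, b, ha, hg, hb, hg0, rfl, hF, hG⟩, hd⟩ := h
  have h1 : V.RegularAt (-1) p := by simpa using regularAt_algebraMap (V := V) (-1) p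
  refine ⟨-F, G, e, e', ⟨-1 * a, g, b, h1.mul ha, hg, hb, hg0, ?_, ⟨neg_ne_zero.mpr hF.1,
    hF.2.1.neg, ?_⟩, hG⟩, hd⟩
  · rw [neg_one_mul, neg_div]
    exact (neg_smul _ _).symm
  · refine hF.2.2.neg_left.congr' ?_ .rfl
    have hm1 := hγ.inCoord_algebraMap (-1)
    rw [map_neg, map_one] at hm1
    filter_upwards [hγ.inCoord_mul h1 ha, hm1] with z hz hz1
    simp only [coeffInCoord, hz, Pi.mul_apply, hz1, map_neg]
    ring

/-- The degree of the lowest term of a log-volume form bounds from below the number of independent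
lowest terms of its members. -/
theorem exists_linearIndependent_polyD (hγ : V.IsCoordinateSystem p γ)
    (ht : V.IsParameterSystem p γ t) {f : Fin n → V.FunctionField} (hf0 : ∀ i, f i ≠ 0)
    (hf : ∀ i, V.RegularAt (f i) p) {F : Fin n → MvPolynomial (Fin n) ℂ} {e : Fin n → ℕ}
    (hF : ∀ i, IsLowestTerm (V.inCoord γ (f i)) (F i) (e i)) {d : ℤ}
    (hd : V.HasLowestDegree p γ (V.logVolumeForm f) d) {q : ℕ} (hqn : q ≤ n) (hq : (q : ℤ) = n - d) :
    ∃ T : Finset (Fin n), T.card = q ∧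
      ∃ v, LinearIndependent ℂ (fun i : T => polyD (F i) v) := by
  by_contra! hdep
  obtain ⟨K, G, k, k', ⟨a, g, b, ha, hg, hb, hg0, hω, hK, hG⟩, hdk⟩ := hd
  have hprod0 : ∏ i, f i ≠ 0 := Finset.prod_ne_zero_iff.mpr fun i _ => hf0 i
  -- Clearing denominators makes every coefficient regular at `p`, so both sides can be expanded
  -- along lines.
  have hform : g • V.wedgeD f = ((∏ i, f i) * a) • V.wedgeD b := by
    have h1 := congrArg (fun ω => (g * ∏ i, f i) • ω) hω
    simp only [logVolumeForm, smul_smul] at h1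
    rwa [mul_assoc, mul_inv_cancel₀ hprod0, mul_one,
      show g * (∏ i, f i) * (a / g) = (∏ i, f i) * a by field_simp] at h1
  have hprod := hγ.inCoord_prod Finset.univ hf
  have hrel : ∀ᶠ z in genericFilter hγ, V.coeffInCoord γ g f z =
      (∏ i, V.inCoord γ (f i) z) * V.coeffInCoord γ a b z := by
    filter_upwards [eventually_coeffInCoord_eq hγ hform,
      (hγ.inCoord_mul hprod.1 ha).filter_mono (genericFilter_le hγ),
      hprod.2.filter_mono (genericFilter_le hγ)] with z h1 h2 h3
    rw [h1, coeffInCoord, h2, Pi.mul_apply, h3, coeffInCoord, mul_assoc]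
  obtain ⟨H, hH0, hline⟩ := exists_eventually_line hγ ht hrel
  have hne : H * ((∏ i, F i) * K) ≠ 0 :=
    mul_ne_zero hH0 (mul_ne_zero (Finset.prod_ne_zero_iff.mpr fun i _ => (hF i).1) hK.1)
  -- A direction in which the right-hand side has its exact order. The form `G` may vanish at `v`,
  -- since only an upper bound for `g` is used.
  obtain ⟨v, hv⟩ : ∃ v, MvPolynomial.eval v (H * ((∏ i, F i) * K)) ≠ 0 := by
    by_contra! hall
    exact hne (MvPolynomial.funext fun v => by rw [hall v, map_zero])
  rw [map_mul, map_mul, map_prod, mul_ne_zero_iff] at hv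
  set c := (∏ i, MvPolynomial.eval v (F i)) * MvPolynomial.eval v K with hc
  have hrhs : HasLineTerm (fun s => (∏ i, V.inCoord γ (f i) (s • v)) *
      V.coeffInCoord γ a b (s • v)) c (∑ i, e i + k) :=
    (HasLineTerm.prod Finset.univ fun i => (hF i).hasLineTerm v).mul (hK.hasLineTerm v)
  have hdet := isBigO_det_of_dependent (q := q)
    (M := fun i j s => s * fderiv ℂ (V.inCoord γ (f i)) (s • v) (Pi.single j 1))
    (A := fun i j => polyD (F i) v (Pi.single j 1)) (e := e) (fun T hT hli => by
      refine hdep T hT v ?_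
      refine LinearIndependent.of_comp
        (LinearMap.pi fun j => (ContinuousLinearMap.apply ℂ ℂ (Pi.single j 1)).toLinearMap :
          Cotangent n →ₗ[ℂ] (Fin n → ℂ)) ?_
      exact hli)
    fun i j => (hF i).hasLineTerm_fderiv (hγ.analyticAt_inCoord (hf i)) v j
  have hlhs := ((hG.hasLineTerm v).isBigO.mul hdet)
  -- The factor `s ^ n` comes from scaling the `n` rows of the Jacobian by `s`. Under the dependence
  -- assumption the exponent is one larger than the exact order.
  have hkey : (fun s : ℂ => s ^ n * ((∏ i, V.inCoord γ (f i) (s • v)) *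
      V.coeffInCoord γ a b (s • v))) =O[𝓝[≠] 0] fun s => s ^ (n + (∑ i, e i + k) + 1) := by
    refine hlhs.congr' ?_ (Filter.Eventually.of_forall fun s => ?_)
    · filter_upwards [hline v hv.1] with s hs
      rw [← hs, coeffInCoord]
      have : (Matrix.of fun i j => s * fderiv ℂ (V.inCoord γ (f i)) (s • v) (Pi.single j 1)) =
          s • Matrix.of fun i j => fderiv ℂ (V.inCoord γ (f i)) (s • v) (Pi.single j 1) := by
        ext i j
        simp
      rw [this, Matrix.det_smul, Fintype.card_fin]
      ring
    · beta_reduce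
      rw [← pow_add]
      congr 1
      -- From `d = k + n - k'` and `q = n - d`.
      have : k' = k + q := by omega
      omega
  have hpow : HasLineTerm (fun s : ℂ => s ^ n) 1 n := by
    simpa [HasLineTerm] using isBigO_zero (E' := ℂ) (fun s : ℂ => s ^ (n + 1)) (𝓝[≠] 0)
  have hterm := hpow.mul hrhs
  rw [one_mul] at hterm
  -- Comparing the two estimates forces the leading coefficient `c` to vanish, against the choice of
  -- `v`.
  refine hv.2 (eq_zero_of_isBigO_pow (Nat.lt_succ_self _) ((hkey.sub hterm).congr_left fun s => ?_))
  ring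

end QuasiAffineVariety

end ClusterPoisson

/-! ### Proof of the main theorem -/

theorem theoremB {N n : ℕ} (V : QuasiAffineVariety N) (hV : V.IsRational n)
    (π : V.PoissonStructure) (ex : Finset (Fin n)) (S₀ : Seed V ex)
    (hreg : S₀.ClassIsRegular) (hcomp : S₀.ClassIsCompatible π)
    (ψ : {j : Fin n // j ∉ ex} → V.FunctionField) (hψ : S₀.IsFrozenModification π ψ) :
    (∀ S : Seed V ex, S₀.MutEquiv S → π.IsLogCanonicalSystem (S.modified ψ)) ∧
    (∀ S T : Seed V ex, S₀.MutEquiv S → S₀.MutEquiv T →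
      V.logVolumeForm (S.modified ψ) = V.logVolumeForm (T.modified ψ) ∨
      V.logVolumeForm (S.modified ψ) = -V.logVolumeForm (T.modified ψ)) ∧
    (∀ p₀ : Fin N → ℂ, V.IsSmoothPoint n p₀ → π.VanishesAt p₀ →
      ∀ γ : (Fin n → ℂ) → (Fin N → ℂ), V.IsCoordinateSystem p₀ γ →
      (∃ (S : Seed V ex) (d : ℤ), S₀.MutEquiv S ∧
        V.HasLowestDegree p₀ γ (V.logVolumeForm (S.modified ψ)) d ∧
        2 * d = (linearRank (π.linearization p₀ γ) : ℤ)) →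
      ∀ S : Seed V ex, S₀.MutEquiv S →
        ∃ F : Fin n → MvPolynomial (Fin n) ℂ,
          (∀ i, ∃ e : ℕ, IsLowestTerm (V.inCoord γ (S.modified ψ i)) (F i) e) ∧
          ContainsIntegrableSystem (π.linearization p₀ γ) F) := by
  have hsys : ∀ S : Seed V ex, S₀.MutEquiv S → π.IsLogCanonicalSystem (S.modified ψ) := fun S hS => by
    have hψS := hψ.of_mutEquiv hS
    refine ⟨fun i => ?_, hψS.wedgeD_modified_ne_zero, hψS.isLogCanonical_modified (hcomp S hS)⟩
    by_cases hi : i ∈ ex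
    · rw [S.modified_of_mem ψ hi]
      exact hreg S hS i
    · rw [S.modified_of_notMem ψ hi]
      refine QuasiAffineVariety.isRegular_of_mem_adjoin ?_ (hψS.2.1 ⟨i, hi⟩)
      rintro _ ⟨j, rfl⟩
      exact hreg S hS j
  have hform : ∀ S T : Seed V ex, S₀.MutEquiv S → S₀.MutEquiv T →
      V.logVolumeForm (S.modified ψ) = V.logVolumeForm (T.modified ψ) ∨
      V.logVolumeForm (S.modified ψ) = -V.logVolumeForm (T.modified ψ) := fun S T hS hT => by
    rcases hS.logVolumeForm_modified hψ with h1 | h1 <;>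
      rcases hT.logVolumeForm_modified hψ with h2 | h2 <;> simp [h1, h2]
  refine ⟨hsys, hform, fun p₀ hp₀ h0 γ hγ ⟨S', d, hS', hdeg, hd⟩ S hS => ?_⟩
  obtain ⟨t, ht⟩ := hγ.exists_parameterSystem hp₀
  have hf0 := (hψ.of_mutEquiv hS).modified_ne_zero
  have hf : ∀ i, V.RegularAt (S.modified ψ i) p₀ := fun i => (hsys S hS).1 i p₀ hγ.mem
  choose e F hF0 hF hlead using fun i => ht.exists_leadingForm hγ.mem (hf i) (hf0 i)
  have hlow := fun i => ht.isLowestTerm hγ (hF0 i) (hF i) (hlead i)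
  -- The degree is known for one cluster `S'`; the form of any other cluster differs at most by a
  -- sign, which does not affect the degree.
  have hdegS : V.HasLowestDegree p₀ γ (V.logVolumeForm (S.modified ψ)) d := by
    rcases hform S S' hS hS' with h | h <;> rw [h]
    · exact hdeg
    · exact hdeg.neg hγ
  have hrk := linearRank_le (π.linearization p₀ γ)
  refine ⟨F, fun i => ⟨e i, hlow i⟩, fun i j v => ?_, ?_⟩
  · rw [h0.polyBracket_eq hγ ht, h0.leadingBracket_eq_zero hγ ht ((hsys S hS).2.2 i j) (hF i) (hF j)
      (hlead i) (hlead j), map_zero]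
  -- Since `2 d` is the rank, which is at most `n`, one has `0 ≤ d ≤ n`; neither `toNat` nor the
  -- subtraction truncates.
  · obtain ⟨T, hT, hind⟩ := QuasiAffineVariety.exists_linearIndependent_polyD hγ ht hf0 hf hlow hdegS
      (q := n - d.toNat) (Nat.sub_le _ _) (by omega)
    exact ⟨T, by omega, hind⟩
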